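/- For a centrally symmetric convex body $K\subset\mathbb R^n$ ($K$ compact, convex, with non-empty interior, $K=-K$; $n\ge1$) the isotropic constant $L_K\ge 0$ is the number determined by $$\int_{T(K)}\langle x,\theta\rangle^2\,dx=L_K^2\quad\text{for all }\theta\in S^{n-1},$$ where $T$ is an invertible linear map such that $T(K)$ has volume $1$ and $\int_{T(K)}\langle x,\theta\rangle^2dx$ does not depend on $\theta\in S^{n-1}$ (such a $T$ exists, and $L_K$ does not depend on its choice). There is a universal constant $C>0$ (independent of $n$, $m$ and $P$) such that the following hold. 1. If $P\subset\mathbb R^n$ is a centrally symmetric convex polytope with non-empty interior and exactly $2m$ facets (faces of dimension $n-1$), then $L_P\le C\sqrt{\log(1+m)}$. 2. If $P\subset\mathbb R^n$ is a centrally symmetric convex polytope with non-empty interior and exactly $2m$ vertices, then $L_P\le C\log(1+m)$. 3. In particular, Gluskin's random polytopes have isotropic constant $O(\log n)$: for every integer $A\ge 0$ there is a constant $C_A>0$ depending only on $A$ such that for all $n\ge1$ and all $0\le k\le An$, if $f_1,\dots,f_k$ are independent and uniformly distributed on $S^{n-1}$, and $e_1,\dots,e_n$ is the standard basis of $\mathbb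 R^n$, then almost surely $K=\mathrm{conv}\{\pm e_1,\dots,\pm e_n,\pm f_1,\dots,\pm f_k\}$ is a centrally symmetric convex polytope with non-empty interior and $L_K\le C_A\log(1+n)$. (For $A=1$ these are polytopes with at most $4n$ vertices, and $C_1$ is a universal constant.) -/

import Mathlib

open MeasureTheory

/-- A centrally symmetric convex body in `ℝⁿ`: a compact convex set with non-empty interior
and `K = -K`. -/
structure IsSymmConvexBody {n : ℕ} (K : Set (EuclideanSpace ℝ (Fin n))) : Prop where
  convex : Convex ℝ K
  isCompact : IsCompact K
  interior_nonempty : (interior K).Nonempty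
  neg_mem : ∀ x ∈ K, -x ∈ K

/-- A (convex) polytope: the convex hull of finitely many points. -/
def IsPolytope {n : ℕ} (P : Set (EuclideanSpace ℝ (Fin n))) : Prop :=
  ∃ S : Set (EuclideanSpace ℝ (Fin n)), S.Finite ∧ P = convexHull ℝ S

/-- A centrally symmetric convex polytope (full-dimensional, like every convex body). -/
def IsSymmPolytope {n : ℕ} (P : Set (EuclideanSpace ℝ (Fin n))) : Prop :=
  IsSymmConvexBody P ∧ IsPolytope P

/-- The set of facets of `P`: the non-empty faces of `P` (sets of maximizers of linear
functionals) of affine dimension `n - 1`. -/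
def facets {n : ℕ} (P : Set (EuclideanSpace ℝ (Fin n))) :
    Set (Set (EuclideanSpace ℝ (Fin n))) :=
  {F | F.Nonempty ∧ IsExposed ℝ P F ∧ Module.finrank ℝ (vectorSpan ℝ F) + 1 = n}

/-- The set of vertices of `P`: its extreme points. -/
def vertices {n : ℕ} (P : Set (EuclideanSpace ℝ (Fin n))) : Set (EuclideanSpace ℝ (Fin n)) :=
  P.extremePoints ℝ

/-- `K` has volume one and is in isotropic position with isotropic constant `L`:
`∫_K ⟨x, θ⟩² dx = L²` for all `θ` in the unit sphere. -/
def IsIsotropicWith {n : ℕ} (K : Set (EuclideanSpace ℝ (Fin n))) (L : ℝ) : Prop :=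
  volume K = 1 ∧ 0 ≤ L ∧
    ∀ θ : EuclideanSpace ℝ (Fin n), ‖θ‖ = 1 → ∫ x in K, (inner ℝ x θ) ^ 2 = L ^ 2

/-- `L` is the isotropic constant `L_K` of the centrally symmetric convex body `K`: the isotropic
constant of an isotropic position of volume one (an image of `K` under an invertible linear
map). -/
def IsIsotropicConstant {n : ℕ} (K : Set (EuclideanSpace ℝ (Fin n))) (L : ℝ) : Prop :=
  ∃ T : EuclideanSpace ℝ (Fin n) ≃L[ℝ] EuclideanSpace ℝ (Fin n), IsIsotropicWith (T '' K) L

/-- `L_K ≤ b`: the isotropic constant of `K` exists, and is at most `b`. -/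
def IsotropicConstantLE {n : ℕ} (K : Set (EuclideanSpace ℝ (Fin n))) (b : ℝ) : Prop :=
  (∃ L : ℝ, IsIsotropicConstant K L) ∧ ∀ L : ℝ, IsIsotropicConstant K L → L ≤ b

/-- The uniform (rotation invariant) probability measure on the Euclidean unit sphere of `ℝⁿ`:
the normalized surface measure. -/
noncomputable def uniformSphere (n : ℕ) :
    Measure (Metric.sphere (0 : EuclideanSpace ℝ (Fin n)) 1) :=
  ((volume : Measure (EuclideanSpace ℝ (Fin n))).toSphere Set.univ)⁻¹ •
    (volume : Measure (EuclideanSpace ℝ (Fin n))).toSphere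

/-- The joint law of `k` independent uniformly distributed points on the unit sphere of `ℝⁿ`. -/
noncomputable def gluskinLaw (n k : ℕ) :
    Measure (Fin k → Metric.sphere (0 : EuclideanSpace ℝ (Fin n)) 1) :=
  Measure.pi fun _ => uniformSphere n

/-- Gluskin's polytope `conv {±e₁, …, ±eₙ, ±f₁, …, ±f_k}`, where `e₁, …, eₙ` is the standard
basis and `f₁, …, f_k` are points of the unit sphere. -/
def gluskinPolytope {n k : ℕ} (f : Fin k → Metric.sphere (0 : EuclideanSpace ℝ (Fin n)) 1) :
    Set (EuclideanSpace ℝ (Fin n)) :=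
  convexHull ℝ
    ({x | ∃ i : Fin n, x = EuclideanSpace.single i (1 : ℝ) ∨ x = -EuclideanSpace.single i (1 : ℝ)} ∪
      {x | ∃ j : Fin k, x = (f j : EuclideanSpace ℝ (Fin n)) ∨
        x = -(f j : EuclideanSpace ℝ (Fin n))})

/-! Put the body in isotropic position, with volume one. Both bounds compare its second moments, all
equal to `L ^ 2`, with a quantity controlled by a union bound over facets or vertices.

Vertices. Let K be the convex hull of N points. A D-optimal design on these points gives an
ellipsoid inside K whose dilate by √n contains the points (`exists_john_ellipsoid`). Let T be the
diagonal map in its axes whose entries are the inverse semi-axes `a i`. Since K has volume one, the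
ellipsoid is not too large, and AM–GM gives `∑ a i ≥ 2√n`; hence the integral of ⟨x, Tx⟩ over K is
`L ^ 2 * ∑ a i ≥ 2 L ^ 2 √n`. On the other hand ⟨x, Tx⟩ is at most the maximum over the N points s
of ⟨x, Ts⟩, where `‖T s‖ ≤ √n`. Linear functionals on a convex body have exponential tails, so this
maximum has mean O(L √n log N) (`setIntegral_le_of_le_abs_inner`). Comparing the two gives L = O(log
N). The tails come from the Brunn–Minkowski inequality, proved here through Prékopa–Leindler.

Facets. Let K be the intersection of N half-spaces ⟨x, y⟩ ≤ 1. By symmetry |⟨x, y⟩| ≤ 1 on K, so `L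
* ‖y‖ ≤ 1`. The Gaussian density exp(-π‖x‖²) is at most 1, so K/2 has Gaussian measure at most 1/2.
Its complement is covered by N half-spaces at distance at least L/2 from the origin, each of measure
at most exp(-πL²/4), whence L² = O(log N). That N may be taken to be the number of facets is polar
duality plus Krein–Milman (`IsSymmPolytope.exists_halfSpaces`).

Gluskin's polytopes are hulls of at most 2(n + k) points, so the vertex argument applies to every
choice of the `f j`. -/

/-! ### Prékopa–Leindler and Brunn–Minkowski inequalities at the midpoint -/

/-- One-dimensional Brunn–Minkowski inequality. -/
theorem Real.volume_add_volume_le {s t C : Set ℝ} (hs : MeasurableSet s) (ht : MeasurableSet t)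
    (hs0 : s.Nonempty) (ht0 : t.Nonempty) (h : ∀ x ∈ s, ∀ y ∈ t, x + y ∈ C) :
    volume s + volume t ≤ volume C := by
  have key : ∀ K L : Set ℝ, IsCompact K → IsCompact L → K.Nonempty → L.Nonempty →
      K ⊆ s → L ⊆ t → volume K + volume L ≤ volume C := by
    intro K L hK hL hK0 hL0 hKs hLt
    -- With a = max K and b = min L, the translates K + b and a + L both lie in the sumset and meet
    -- only at a + b.
    obtain ⟨a, haK, ha⟩ := hK.exists_isGreatest hK0
    obtain ⟨b, hbL, hb⟩ := hL.exists_isLeast hL0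
    have h1 : volume ((fun x => x + b) '' K) = volume K := by
      rw [Set.image_add_right]; exact measure_preimage_add_right _ _ _
    have h2 : volume ((fun x => a + x) '' L) = volume L := by
      rw [Set.image_add_left]; exact measure_preimage_add _ _ _
    rw [← h1, ← h2, ← measure_union₀]
    · apply measure_mono
      rintro z (⟨x, hx, rfl⟩ | ⟨x, hx, rfl⟩)
      · exact h x (hKs hx) b (hLt hbL)
      · exact h a (hKs haK) x (hLt hx)
    · exact (hL.image (by fun_prop)).measurableSet.nullMeasurableSet
    · refine measure_mono_null (t := {a + b}) ?_ (by simp)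
      rintro z ⟨⟨x, hx, rfl⟩, ⟨y, hy, hxy⟩⟩
      have h3 := ha hx
      have h4 := hb hy
      simp only at hxy
      simp only [Set.mem_singleton_iff]
      linarith
  obtain ⟨x₀, hx₀⟩ := hs0
  obtain ⟨y₀, hy₀⟩ := ht0
  rw [hs.measure_eq_iSup_isCompact, ht.measure_eq_iSup_isCompact]
  simp only [iSup_and']
  refine ENNReal.biSup_add_biSup_le' ⟨∅, by simp⟩ ⟨∅, by simp⟩ ?_
  rintro K ⟨hKs, hK⟩ L ⟨hLt, hL⟩
  -- The approximating compact sets may be empty; adding one point to each makes `key` applicable.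
  refine le_trans ?_ (key (insert x₀ K) (insert y₀ L) (hK.insert _) (hL.insert _)
    (Set.insert_nonempty _ _) (Set.insert_nonempty _ _) (Set.insert_subset hx₀ hKs)
    (Set.insert_subset hy₀ hLt))
  gcongr <;> exact Set.subset_insert _ _

/-- Additive Prékopa–Leindler inequality on the line for functions with supremum one. -/
theorem Real.lintegral_add_lintegral_le_of_midpoint {f g h : ℝ → ℝ} (hf : Measurable f)
    (hg : Measurable g) (hh : Measurable h) (f0 : ∀ x, 0 ≤ f x) (g0 : ∀ x, 0 ≤ g x)
    (h0 : ∀ x, 0 ≤ h x) (f1 : ∀ x, f x ≤ 1) (g1 : ∀ x, g x ≤ 1)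
    (fs : ∀ s < 1, ∃ x, s < f x) (gs : ∀ s < 1, ∃ x, s < g x)
    (H : ∀ x y, f x * g y ≤ h ((x + y) / 2) ^ 2) :
    (∫⁻ x, ENNReal.ofReal (f x)) + ∫⁻ x, ENNReal.ofReal (g x) ≤
      2 * ∫⁻ x, ENNReal.ofReal (h x) := by
  -- Layer cake. For s < 1 the superlevel sets of f and g are non-empty and their sum lies in twice
  -- that of h; for s ≥ 1 they are empty.
  rw [lintegral_eq_lintegral_meas_lt _ (Filter.Eventually.of_forall f0) hf.aemeasurable,
    lintegral_eq_lintegral_meas_lt _ (Filter.Eventually.of_forall g0) hg.aemeasurable,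
    lintegral_eq_lintegral_meas_lt _ (Filter.Eventually.of_forall h0) hh.aemeasurable,
    ← lintegral_const_mul' _ _ (by simp), ← lintegral_add_left]
  · refine setLIntegral_mono' measurableSet_Ioi fun s hs => ?_
    have hs' : (0 : ℝ) < s := hs
    by_cases h1 : s < 1
    · have e : volume ((fun x => 2 * x) '' {a | s < h a}) = 2 * volume {a | s < h a} := by
        have := Measure.addHaar_image_linearMap (volume : Measure ℝ)
          ((2 : ℝ) • LinearMap.id) {a | s < h a}
        simpa using this
      rw [← e]
      refine Real.volume_add_volume_le (measurableSet_lt measurable_const hf)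
        (measurableSet_lt measurable_const hg) (fs s h1) (gs s h1) ?_
      intro x hx y hy
      refine ⟨(x + y) / 2, ?_, by ring⟩
      simp only [Set.mem_ofPred_eq] at *
      refine lt_of_pow_lt_pow_left₀ 2 (h0 _) (lt_of_lt_of_le ?_ (H x y))
      nlinarith
    · have e1 : {a | s < f a} = ∅ := by
        ext x; simp only [Set.mem_ofPred_eq, Set.mem_empty_iff_false, iff_false]
        linarith [f1 x]
      have e2 : {a | s < g a} = ∅ := by
        ext x; simp only [Set.mem_ofPred_eq, Set.mem_empty_iff_false, iff_false]
        linarith [g1 x]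
      simp [e1, e2]
  · have : Antitone fun t => volume {a | t < f a} := fun s t hst =>
      measure_mono fun x (hx : t < f x) => lt_of_le_of_lt hst hx
    exact this.measurable

theorem ENNReal.four_mul_le_add_sq (u v : ENNReal) : 4 * (u * v) ≤ (u + v) ^ 2 := by
  by_cases hu : u = ⊤
  · subst hu; simp
  by_cases hv : v = ⊤
  · subst hv; simp
  lift u to NNReal using hu
  lift v to NNReal using hv
  norm_cast
  rw [← NNReal.coe_le_coe]
  push_cast
  nlinarith [sq_nonneg ((u : ℝ) - v)]

/-- `E` satisfies the midpoint Prékopa–Leindler inequality. -/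
def PrekopaLeindler (E : Type*) [AddCommGroup E] [Module ℝ E] [MeasureSpace E] : Prop :=
  ∀ f g h : E → ENNReal, Measurable f → Measurable g → Measurable h →
    (∀ x y, f x * g y ≤ h ((2⁻¹ : ℝ) • (x + y)) ^ 2) →
    (∫⁻ x, f x) * (∫⁻ x, g x) ≤ (∫⁻ x, h x) ^ 2

/-- Dividing f and g by their suprema a, b and h by c = √(ab) reduces to the additive inequality,
which AM–GM turns into a product; the normalisations then cancel because c² = ab. -/
theorem lintegral_mul_le_of_bounded {f g h : ℝ → ENNReal} (hf : Measurable f) (hg : Measurable g)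
    (hh : Measurable h) (H : ∀ x y, f x * g y ≤ h ((2⁻¹ : ℝ) • (x + y)) ^ 2)
    (hfa : ⨆ x, f x ≠ ⊤) (hgb : ⨆ x, g x ≠ ⊤) :
    (∫⁻ x, f x) * (∫⁻ x, g x) ≤ (∫⁻ x, h x) ^ 2 := by
  have hfle : ∀ x, f x ≤ ⨆ x, f x := le_iSup f
  have hgle : ∀ x, g x ≤ ⨆ x, g x := le_iSup g
  have hfs : ∀ t < ⨆ x, f x, ∃ x, t < f x := fun t ht => lt_iSup_iff.1 ht
  have hgs : ∀ t < ⨆ x, g x, ∃ x, t < g x := fun t ht => lt_iSup_iff.1 ht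
  generalize (⨆ x, f x) = a at *
  generalize (⨆ x, g x) = b at *
  by_cases ha : a = 0
  · have : f = 0 := by ext x; simpa [ha] using hfle x
    simp [this]
  by_cases hb : b = 0
  · have : g = 0 := by ext x; simpa [hb] using hgle x
    simp [this]
  obtain ⟨c, hc⟩ : ∃ c : ENNReal, c ^ 2 = a * b := by
    refine ⟨(a * b) ^ (2⁻¹ : ℝ), ?_⟩
    rw [← ENNReal.rpow_natCast, ← ENNReal.rpow_mul]
    norm_num
  have hab0 : a * b ≠ 0 := mul_ne_zero ha hb
  have habt : a * b ≠ ⊤ := ENNReal.mul_ne_top hfa hgb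
  have hct : c ≠ ⊤ := by
    rintro rfl
    exact habt (by rw [← hc]; simp)
  have hc0 : c ≠ 0 := by
    rintro rfl
    exact hab0 (by rw [← hc]; simp)
  have f1 : ∀ x, f x / a ≤ 1 := fun x => ENNReal.div_le_of_le_mul (by simpa using hfle x)
  have g1 : ∀ x, g x / b ≤ 1 := fun x => ENNReal.div_le_of_le_mul (by simpa using hgle x)
  -- Capping at 1 makes `toReal` faithful where h is infinite, and costs nothing since the
  -- normalised f and g are at most 1.
  have h1 : ∀ x, min (h x / c) 1 ≠ ⊤ := fun x => (min_le_right _ _).trans_lt (by simp) |>.ne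
  have H' : ∀ x y, f x / a * (g y / b) ≤ (min (h ((2⁻¹ : ℝ) • (x + y)) / c) 1) ^ 2 := by
    intro x y
    rcases min_choice (h ((2⁻¹ : ℝ) • (x + y)) / c) 1 with e | e <;> rw [e]
    · rw [div_eq_mul_inv, div_eq_mul_inv, mul_mul_mul_comm,
        ← ENNReal.mul_inv (Or.inl ha) (Or.inl hfa), ← hc, div_eq_mul_inv, mul_pow,
        ENNReal.inv_pow]
      gcongr
      exact H x y
    · simpa using mul_le_mul' (f1 x) (g1 y)
  have sup1 : ∀ (f : ℝ → ENNReal) (a : ENNReal), a ≠ 0 → a ≠ ⊤ → (∀ t < a, ∃ x, t < f x) →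
      (∀ x, f x / a ≤ 1) → ∀ s < 1, ∃ x, s < (f x / a).toReal := by
    intro f a ha hfa hfs f1 s hs
    obtain ⟨x, hx⟩ := hfs (ENNReal.ofReal (max s 0) * a) (by
      conv_rhs => rw [← one_mul a]
      exact (ENNReal.mul_lt_mul_iff_left ha hfa).2 (by simpa using hs))
    refine ⟨x, (le_max_left s 0).trans_lt ?_⟩
    rw [← ENNReal.ofReal_lt_iff_lt_toReal (le_max_right s 0)
      ((f1 x).trans_lt ENNReal.one_lt_top).ne]
    rwa [ENNReal.lt_div_iff_mul_lt (Or.inl ha) (Or.inl hfa)]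
  have key := Real.lintegral_add_lintegral_le_of_midpoint
    (f := fun x => (f x / a).toReal) (g := fun x => (g x / b).toReal)
    (h := fun x => (min (h x / c) 1).toReal)
    (by fun_prop) (by fun_prop) (by fun_prop) (fun _ => ENNReal.toReal_nonneg)
    (fun _ => ENNReal.toReal_nonneg) (fun _ => ENNReal.toReal_nonneg)
    (fun x => ENNReal.toReal_le_of_le_ofReal zero_le_one (by simpa using f1 x))
    (fun x => ENNReal.toReal_le_of_le_ofReal zero_le_one (by simpa using g1 x))
    ?_ ?_ ?_
  · simp only [fun x => ENNReal.ofReal_toReal ((f1 x).trans_lt ENNReal.one_lt_top).ne,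
      fun x => ENNReal.ofReal_toReal ((g1 x).trans_lt ENNReal.one_lt_top).ne,
      fun x => ENNReal.ofReal_toReal (h1 x)] at key
    have key2 : (∫⁻ x, f x) / a + (∫⁻ x, g x) / b ≤ 2 * ((∫⁻ x, h x) / c) := by
      simp only [div_eq_mul_inv] at key ⊢
      rw [lintegral_mul_const _ hf, lintegral_mul_const _ hg] at key
      refine key.trans ?_
      rw [← lintegral_mul_const _ hh]
      gcongr
      exact min_le_left _ _
    have key3 := (ENNReal.four_mul_le_add_sq _ _).trans (pow_le_pow_left' key2 2)
    rw [mul_pow, show (2 : ENNReal) ^ 2 = 4 by norm_num,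
      ENNReal.mul_le_mul_iff_right (by norm_num) (by norm_num), div_eq_mul_inv, div_eq_mul_inv,
      mul_mul_mul_comm, ← ENNReal.mul_inv (Or.inl ha) (Or.inl hfa), div_eq_mul_inv, mul_pow,
      ← ENNReal.inv_pow, hc, ENNReal.mul_le_mul_iff_left (ENNReal.inv_ne_zero.2 habt)
        (ENNReal.inv_ne_top.2 hab0)] at key3
    exact key3
  · intro s hs
    exact sup1 f a ha hfa hfs f1 s hs
  · intro s hs
    exact sup1 g b hb hgb hgs g1 s hs
  · intro x y
    rw [← ENNReal.toReal_mul, ← ENNReal.toReal_pow]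
    refine ENNReal.toReal_mono (ENNReal.pow_ne_top (h1 _)) ?_
    have := H' x y
    rwa [smul_eq_mul, mul_comm (2⁻¹ : ℝ), ← div_eq_mul_inv] at this

/-- Truncating f and g preserves the hypothesis, and monotone convergence removes the truncation. -/
theorem prekopaLeindler_real : PrekopaLeindler ℝ := by
  intro f g h hf hg hh H
  have lim : ∀ f : ℝ → ENNReal, Measurable f →
      ⨆ n : ℕ, ∫⁻ x, min (f x) (n : ENNReal) = ∫⁻ x, f x := by
    intro f hf
    rw [← lintegral_iSup (f := fun (n : ℕ) x => min (f x) (n : ENNReal))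
      (fun n => hf.min measurable_const)
      (fun m n hmn x => min_le_min le_rfl (by exact_mod_cast hmn))]
    congr with x
    rw [← inf_iSup_eq, ENNReal.iSup_natCast, inf_top_eq]
  have bdd : ∀ (f : ℝ → ENNReal) (n : ℕ), ⨆ x, min (f x) (n : ENNReal) ≠ ⊤ := fun f n =>
    ((iSup_le fun x => min_le_right _ _).trans_lt (ENNReal.natCast_lt_top n)).ne
  rw [← lim f hf, ← lim g hg, ENNReal.iSup_mul]
  refine iSup_le fun m => ?_
  rw [ENNReal.mul_iSup]
  refine iSup_le fun n => lintegral_mul_le_of_bounded (hf.min measurable_const)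
    (hg.min measurable_const) hh ?_
      (bdd f m) (bdd g n)
  intro x y
  exact (mul_le_mul' (min_le_left _ _) (min_le_left _ _)).trans (H x y)

/-- Fubini: the inequality on fibres over F is exactly the hypothesis needed by the marginals on E.
-/
theorem PrekopaLeindler.prod {E F : Type*} [AddCommGroup E] [Module ℝ E] [MeasureSpace E]
    [AddCommGroup F] [Module ℝ F] [MeasureSpace F] [SFinite (volume : Measure E)]
    [SFinite (volume : Measure F)]
    (hE : PrekopaLeindler E) (hF : PrekopaLeindler F) : PrekopaLeindler (E × F) := by
  intro f g h hf hg hh H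
  simp only [Measure.volume_eq_prod]
  rw [lintegral_prod _ hf.aemeasurable, lintegral_prod _ hg.aemeasurable,
    lintegral_prod _ hh.aemeasurable]
  refine hE _ _ _ hf.lintegral_prod_right' hg.lintegral_prod_right' hh.lintegral_prod_right' ?_
  intro x y
  refine hF _ _ _ (by fun_prop) (by fun_prop) (by fun_prop) ?_
  intro x' y'
  exact H (x, x') (y, y')

theorem PrekopaLeindler.of_measurePreserving {E F : Type*} [AddCommGroup E] [Module ℝ E]
    [MeasureSpace E] [AddCommGroup F] [Module ℝ F] [MeasureSpace F] (hE : PrekopaLeindler E)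
    (e : E →ₗ[ℝ] F) (he : MeasurePreserving e volume volume) : PrekopaLeindler F := by
  intro f g h hf hg hh H
  rw [← he.lintegral_comp hf, ← he.lintegral_comp hg, ← he.lintegral_comp hh]
  refine hE _ _ _ (hf.comp he.measurable) (hg.comp he.measurable) (hh.comp he.measurable) ?_
  intro x y
  simpa using H (e x) (e y)

theorem prekopaLeindler_pi (n : ℕ) : PrekopaLeindler (Fin n → ℝ) := by
  induction n with
  | zero =>
    intro f g h hf hg hh H
    have e : ∀ f : (Fin 0 → ℝ) → ENNReal, ∫⁻ x, f x = f 0 := by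
      intro f
      rw [lintegral_unique, volume_pi, Measure.pi_empty_univ, mul_one]
      exact congrArg f (Subsingleton.elim _ _)
    rw [e, e, e]
    simpa using H 0 0
  | succ n ih =>
    refine (prekopaLeindler_real.prod ih).of_measurePreserving
      (Fin.consLinearEquiv ℝ (fun _ : Fin (n + 1) => ℝ)).toLinearMap ?_
    have := (volume_preserving_piFinSuccAbove (fun _ : Fin (n + 1) => ℝ) 0).symm
    have e : ⇑(MeasurableEquiv.piFinSuccAbove (fun _ : Fin (n + 1) => ℝ) 0).symm =
        ⇑(Fin.consLinearEquiv ℝ (fun _ : Fin (n + 1) => ℝ)) := by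
      ext p i
      refine Fin.cases ?_ (fun i => ?_) i <;> simp [Fin.consLinearEquiv]
    rw [e] at this
    exact this

theorem prekopaLeindler_euclideanSpace (n : ℕ) : PrekopaLeindler (EuclideanSpace ℝ (Fin n)) :=
  (prekopaLeindler_pi n).of_measurePreserving
    (WithLp.linearEquiv 2 ℝ (Fin n → ℝ)).symm.toLinearMap (PiLp.volume_preserving_toLp (Fin n))

/-- Multiplicative Brunn–Minkowski inequality at the midpoint. -/
theorem EuclideanSpace.volume_mul_volume_le {n : ℕ} {A B C : Set (EuclideanSpace ℝ (Fin n))}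
    (hA : MeasurableSet A) (hB : MeasurableSet B) (hC : MeasurableSet C)
    (h : ∀ x ∈ A, ∀ y ∈ B, (2⁻¹ : ℝ) • (x + y) ∈ C) :
    volume A * volume B ≤ volume C ^ 2 := by
  have := prekopaLeindler_euclideanSpace n (A.indicator 1) (B.indicator 1) (C.indicator 1)
    (measurable_one.indicator hA) (measurable_one.indicator hB) (measurable_one.indicator hC) ?_
  · simpa [lintegral_indicator_one, hA, hB, hC] using this
  · intro x y
    by_cases hx : x ∈ A
    · by_cases hy : y ∈ B
      · rw [Set.indicator_of_mem (h x hx y hy)]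
        simp [hx, hy]
      · simp [hy]
    · simp [hx]

/-! ### Exponential tails of linear functionals on a symmetric convex body -/

section Tail

variable {n : ℕ} {K : Set (EuclideanSpace ℝ (Fin n))}

/-- If φ(t) is twice the volume of the part of K where ⟨x, w⟩ ≥ t, Brunn–Minkowski and φ(0) ≥ 1 give
φ(2t) ≤ φ(t)². Chebyshev gives φ(2σ) ≤ 1/2, and repeated squaring produces exponential decay. -/
theorem volume_real_halfspace_le (hK : Convex ℝ K) (hc : IsCompact K) (hs : ∀ x ∈ K, -x ∈ K)
    (hv : volume K = 1) {w : EuclideanSpace ℝ (Fin n)} {σ : ℝ} (hσ : 0 < σ)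
    (hw : ∫ x in K, (inner ℝ x w) ^ 2 ≤ σ ^ 2) (t : ℝ) :
    volume.real (K ∩ {x | t ≤ inner ℝ x w}) ≤ 2 * Real.exp (-t / (8 * σ)) := by
  have hKm := hc.measurableSet
  have hm : ∀ t : ℝ, MeasurableSet (K ∩ {x | t ≤ inner ℝ x w}) := fun t =>
    hKm.inter (measurableSet_le measurable_const (by fun_prop))
  have hfin : ∀ t : ℝ, volume (K ∩ {x | t ≤ inner ℝ x w}) ≠ ⊤ := fun t =>
    (measure_mono Set.inter_subset_left |>.trans_lt (by simp [hv])).ne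
  have hK1 : volume.real K = 1 := by simp [measureReal_def, hv]
  have sq : ∀ t : ℝ, volume.real (K ∩ {x | 2 * t ≤ inner ℝ x w}) *
      volume.real (K ∩ {x | 0 ≤ inner ℝ x w}) ≤ volume.real (K ∩ {x | t ≤ inner ℝ x w}) ^ 2 := by
    intro t
    simp only [measureReal_def]
    rw [← ENNReal.toReal_mul, ← ENNReal.toReal_pow]
    refine ENNReal.toReal_mono (ENNReal.pow_ne_top (hfin _)) ?_
    refine EuclideanSpace.volume_mul_volume_le (hm _) (hm _) (hm _) ?_
    rintro x ⟨hx, hxt⟩ y ⟨hy, hyt⟩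
    refine ⟨?_, ?_⟩
    · rw [smul_add]
      exact hK hx hy (by norm_num) (by norm_num) (by norm_num)
    · simp only [Set.mem_ofPred_eq, inner_smul_left, inner_add_left] at *
      simp only [conj_trivial]
      linarith
  have half : 1 ≤ 2 * volume.real (K ∩ {x | 0 ≤ inner ℝ x w}) := by
    have e : volume.real (K ∩ {x | inner ℝ x w ≤ 0}) =
        volume.real (K ∩ {x | 0 ≤ inner ℝ x w}) := by
      rw [measureReal_def, measureReal_def, ← Measure.measure_neg]
      congr 2
      ext x
      simp only [Set.mem_neg, Set.mem_inter_iff, Set.mem_ofPred_eq, inner_neg_left]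
      constructor
      · rintro ⟨h1, h2⟩; exact ⟨by simpa using hs _ h1, by linarith⟩
      · rintro ⟨h1, h2⟩; exact ⟨hs _ h1, by linarith⟩
    have : K ⊆ (K ∩ {x | inner ℝ x w ≤ 0}) ∪ (K ∩ {x | 0 ≤ inner ℝ x w}) := by
      intro x hx
      rcases le_total (inner ℝ x w) 0 with h | h
      · exact Or.inl ⟨hx, h⟩
      · exact Or.inr ⟨hx, h⟩
    have h2 := (measureReal_mono this (by
      refine (measure_mono (μ := volume) (t := K) ?_ |>.trans_lt (by simp [hv])).ne
      exact Set.union_subset Set.inter_subset_left Set.inter_subset_left)).trans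
      (measureReal_union_le _ _)
    rw [hK1, e] at h2
    linarith
  have cheb : 2 * volume.real (K ∩ {x | 2 * σ ≤ inner ℝ x w}) ≤ 1 / 2 := by
    have hi : IntegrableOn (fun x => (inner ℝ x w) ^ 2) K :=
      ContinuousOn.integrableOn_compact hc (by fun_prop)
    have h1 := mul_meas_ge_le_integral_of_nonneg (μ := volume.restrict K)
      (Filter.Eventually.of_forall fun x => sq_nonneg (inner ℝ x w)) hi ((2 * σ) ^ 2)
    rw [measureReal_restrict_apply (measurableSet_le (f := fun _ => (2 * σ) ^ 2)
      measurable_const (by fun_prop))] at h1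
    have h2 : volume.real (K ∩ {x | 2 * σ ≤ inner ℝ x w}) ≤
        volume.real ({x | (2 * σ) ^ 2 ≤ (inner ℝ x w) ^ 2} ∩ K) := by
      refine measureReal_mono ?_
        (measure_mono Set.inter_subset_right |>.trans_lt (by simp [hv])).ne
      rintro x ⟨hx, hxt⟩
      have hxt' : 2 * σ ≤ inner ℝ x w := hxt
      exact ⟨pow_le_pow_left₀ (by positivity) hxt' 2, hx⟩
    have h3 : (2 * σ) ^ 2 * volume.real (K ∩ {x | 2 * σ ≤ inner ℝ x w}) ≤ σ ^ 2 :=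
      (mul_le_mul_of_nonneg_left h2 (by positivity)).trans (h1.trans hw)
    have h4 : 0 < σ ^ 2 := by positivity
    nlinarith
  have dyadic : ∀ k : ℕ, 2 * volume.real (K ∩ {x | 2 ^ k * (2 * σ) ≤ inner ℝ x w}) ≤
      (1 / 2) ^ (2 ^ k) := by
    intro k
    induction k with
    | zero => simpa using cheb
    | succ k ih =>
      have h1 := sq (2 ^ k * (2 * σ))
      rw [pow_succ (2 : ℝ) k, pow_succ (2 : ℕ) k, pow_mul, mul_comm ((2 : ℝ) ^ k) 2, mul_assoc]
      have h2 : 0 ≤ volume.real (K ∩ {x | 2 * (2 ^ k * (2 * σ)) ≤ inner ℝ x w}) :=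
        measureReal_nonneg
      have h3 := pow_le_pow_left₀ (by positivity) ih 2
      nlinarith
  have mono : ∀ s t : ℝ, s ≤ t → volume.real (K ∩ {x | t ≤ inner ℝ x w}) ≤
      volume.real (K ∩ {x | s ≤ inner ℝ x w}) := fun s t hst =>
    measureReal_mono (Set.inter_subset_inter_right _ fun x (hx : t ≤ _) => hst.trans hx) (hfin _)
  rcases le_or_gt (2 * σ) t with ht | ht
  · obtain ⟨k, hk1, hk2⟩ := exists_nat_pow_near (x := t / (2 * σ)) (y := (2 : ℝ))
      (by rw [le_div_iff₀ (by positivity)]; linarith) (by norm_num)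
    rw [le_div_iff₀ (by positivity)] at hk1
    rw [div_lt_iff₀ (by positivity)] at hk2
    have h1 := (mul_le_mul_of_nonneg_left (mono _ _ hk1) zero_le_two).trans (dyadic k)
    have h2 : ((1 : ℝ) / 2) ^ (2 ^ k) = Real.exp (-(Real.log 2 * 2 ^ k)) := by
      rw [← Real.rpow_natCast, Real.rpow_def_of_pos (by norm_num)]
      simp
    rw [h2] at h1
    have h3 : Real.exp (-(Real.log 2 * 2 ^ k)) ≤ Real.exp (-t / (8 * σ)) := by
      apply Real.exp_le_exp.2
      rw [neg_div, neg_le_neg_iff, div_le_iff₀ (by positivity)]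
      have h4 := Real.log_two_gt_d9
      have h5 : (0 : ℝ) < 2 ^ k * σ := by positivity
      rw [pow_succ] at hk2
      nlinarith
    have h6 := Real.exp_pos (-t / (8 * σ))
    have h7 : 0 ≤ volume.real (K ∩ {x | t ≤ inner ℝ x w}) := measureReal_nonneg
    linarith
  · have h1 : volume.real (K ∩ {x | t ≤ inner ℝ x w}) ≤ 1 := by
      rw [← hK1]
      exact measureReal_mono Set.inter_subset_left (by simp [hv])
    have h2 := Real.add_one_le_exp (-t / (8 * σ))
    have h3 : -(1 / 4) ≤ -t / (8 * σ) := by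
      rw [le_div_iff₀ (by positivity)]
      linarith
    linarith

theorem setIntegral_max_abs_inner_sub_le (hK : Convex ℝ K) (hc : IsCompact K)
    (hs : ∀ x ∈ K, -x ∈ K) (hv : volume K = 1) {w : EuclideanSpace ℝ (Fin n)} {σ : ℝ} (hσ : 0 < σ)
    (hw : ∫ x in K, (inner ℝ x w) ^ 2 ≤ σ ^ 2) (u : ℝ) :
    ∫ x in K, max (|inner ℝ x w| - u) 0 ≤ 32 * σ * Real.exp (-u / (8 * σ)) := by
  have tail : ∀ t : ℝ, volume.real (K ∩ {x | t ≤ |inner ℝ x w|}) ≤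
      4 * Real.exp (-t / (8 * σ)) := by
    intro t
    have h1 := volume_real_halfspace_le hK hc hs hv hσ hw t
    have h2 := volume_real_halfspace_le hK hc hs hv (w := -w) hσ (by simpa using hw) t
    have h3 : K ∩ {x | t ≤ |inner ℝ x w|} ⊆
        (K ∩ {x | t ≤ inner ℝ x w}) ∪ (K ∩ {x | t ≤ inner ℝ x (-w)}) := by
      rintro x ⟨hx, hxt⟩
      rcases le_abs.1 (Set.mem_ofPred_eq.mp hxt) with h | h
      · exact Or.inl ⟨hx, h⟩
      · exact Or.inr ⟨hx, by simpa using h⟩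
    have h4 := (measureReal_mono h3 (by
      refine (measure_mono (μ := volume) (t := K) ?_ |>.trans_lt (by simp [hv])).ne
      exact Set.union_subset Set.inter_subset_left Set.inter_subset_left)).trans
      (measureReal_union_le _ _)
    linarith
  have hi : IntegrableOn (fun x => max (|inner ℝ x w| - u) 0) K :=
    ContinuousOn.integrableOn_compact hc (by fun_prop)
  rw [hi.integral_eq_integral_meas_lt (Filter.Eventually.of_forall fun x => le_max_right _ _)]
  have hexp : IntegrableOn (fun t : ℝ => 4 * Real.exp (-u / (8 * σ)) * Real.exp (-(1 / (8 * σ)) * t))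
      (Set.Ioi 0) := (integrableOn_exp_mul_Ioi (by simpa using hσ) 0).const_mul _
  calc _ ≤ ∫ t in Set.Ioi (0 : ℝ),
        4 * Real.exp (-u / (8 * σ)) * Real.exp (-(1 / (8 * σ)) * t) := by
        refine integral_mono_of_nonneg (Filter.Eventually.of_forall fun t => measureReal_nonneg)
          hexp ?_
        filter_upwards [ae_restrict_mem measurableSet_Ioi] with t ht
        rw [measureReal_restrict_apply (measurableSet_lt measurable_const (by fun_prop))]
        have h1 := tail (t + u)
        have h2 : {x | t < max (|inner ℝ x w| - u) 0} ∩ K ⊆ K ∩ {x | t + u ≤ |inner ℝ x w|} := by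
          rintro x ⟨hx, hxK⟩
          refine ⟨hxK, ?_⟩
          have ht' : 0 < t := ht
          rcases lt_max_iff.1 (Set.mem_ofPred_eq.mp hx) with h | h
          · simp only [Set.mem_ofPred_eq]; linarith
          · linarith
        refine (measureReal_mono h2
          (measure_mono Set.inter_subset_left |>.trans_lt (by simp [hv])).ne).trans
          (h1.trans (le_of_eq ?_))
        rw [mul_assoc, ← Real.exp_add]
        congr 2
        field_simp
        ring
    _ = _ := by
        rw [integral_const_mul, integral_exp_mul_Ioi (by simpa using hσ)]
        simp
        ring

/-- The maximum of `N` linear functionals with second moments at most `σ²` has mean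
`O(σ log N)` on a symmetric convex body of volume one. -/
theorem setIntegral_le_of_le_abs_inner (hK : Convex ℝ K) (hc : IsCompact K)
    (hs : ∀ x ∈ K, -x ∈ K) (hv : volume K = 1) {σ : ℝ} (hσ : 0 < σ)
    {S : Finset (EuclideanSpace ℝ (Fin n))} (hS : S.Nonempty)
    (hw : ∀ w ∈ S, ∫ x in K, (inner ℝ x w) ^ 2 ≤ σ ^ 2) {Φ : EuclideanSpace ℝ (Fin n) → ℝ}
    (hΦ : IntegrableOn Φ K) (hle : ∀ x ∈ K, ∃ w ∈ S, Φ x ≤ |inner ℝ x w|) :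
    ∫ x in K, Φ x ≤ 8 * σ * (Real.log S.card + 4) := by
  have hN : (0 : ℝ) < S.card := by exact_mod_cast hS.card_pos
  -- At this threshold each excess integral is at most 32σ/N, so the N of them add up to 32σ.
  set u := 8 * σ * Real.log S.card with hu
  have hi : ∀ w ∈ S, IntegrableOn (fun x => max (|inner ℝ x w| - u) 0) K := fun w _ =>
    ContinuousOn.integrableOn_compact hc (by fun_prop)
  have hconst : IntegrableOn (fun _ => u) K volume := by simp [hv]
  calc ∫ x in K, Φ x ≤ ∫ x in K, (u + ∑ w ∈ S, max (|inner ℝ x w| - u) 0) := by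
        refine setIntegral_mono_on hΦ (hconst.add (integrable_finsetSum _ hi)) hc.measurableSet ?_
        intro x hx
        obtain ⟨w, hwS, hxw⟩ := hle x hx
        have := Finset.single_le_sum (f := fun w => max (|inner ℝ x w| - u) 0)
          (fun w _ => le_max_right _ _) hwS
        have h2 := le_max_left (|inner ℝ x w| - u) 0
        linarith
    _ = u + ∑ w ∈ S, ∫ x in K, max (|inner ℝ x w| - u) 0 := by
        rw [integral_add hconst (integrable_finsetSum _ hi), integral_finsetSum _ hi]
        simp [measureReal_def, hv]
    _ ≤ u + ∑ w ∈ S, 32 * σ * Real.exp (-u / (8 * σ)) := by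
        refine add_le_add_right (Finset.sum_le_sum fun w hwS => ?_) _
        exact setIntegral_max_abs_inner_sub_le hK hc hs hv hσ (hw w hwS) u
    _ = _ := by
        have : -u / (8 * σ) = - Real.log S.card := by rw [hu]; field_simp
        rw [this, Real.exp_neg, Real.exp_log hN, Finset.sum_const, nsmul_eq_mul, hu]
        field_simp
        ring

end Tail

/-! ### D-optimal designs -/

section Design

open Matrix

variable {ι : Type*} [Fintype ι] {n : ℕ}

/-- The moment matrix of the points `v i` with weights `p i`. -/
def momentMatrix (v : ι → Fin n → ℝ) (p : ι → ℝ) : Matrix (Fin n) (Fin n) ℝ :=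
  ∑ i, p i • vecMulVec (v i) (v i)

theorem dotProduct_momentMatrix_mulVec (v : ι → Fin n → ℝ) (p : ι → ℝ) (x : Fin n → ℝ) :
    x ⬝ᵥ (momentMatrix v p *ᵥ x) = ∑ i, p i * (v i ⬝ᵥ x) ^ 2 := by
  simp only [momentMatrix, sum_mulVec, smul_mulVec, vecMulVec_mulVec, dotProduct_sum,
    dotProduct_smul]
  refine Finset.sum_congr rfl fun i _ => ?_
  rw [op_smul_eq_smul, dotProduct_comm x, smul_eq_mul, smul_eq_mul]
  ring

theorem momentMatrix_isHermitian (v : ι → Fin n → ℝ) (p : ι → ℝ) :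
    (momentMatrix v p).IsHermitian := by
  simp only [momentMatrix, IsHermitian, conjTranspose_sum, conjTranspose_smul]
  refine Finset.sum_congr rfl fun i _ => ?_
  ext j k
  simp [vecMulVec_apply]

theorem momentMatrix_posSemidef (v : ι → Fin n → ℝ) {p : ι → ℝ} (hp : ∀ i, 0 ≤ p i) :
    (momentMatrix v p).PosSemidef := by
  refine PosSemidef.of_dotProduct_mulVec_nonneg (momentMatrix_isHermitian v p) fun x => ?_
  rw [star_trivial, dotProduct_momentMatrix_mulVec]
  exact Finset.sum_nonneg fun i _ => mul_nonneg (hp i) (sq_nonneg _)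

theorem momentMatrix_posDef {v : ι → Fin n → ℝ} {p : ι → ℝ} (hp : ∀ i, 0 < p i)
    (hv : ∀ x, (∀ i, v i ⬝ᵥ x = 0) → x = 0) : (momentMatrix v p).PosDef := by
  refine PosDef.of_dotProduct_mulVec_pos (momentMatrix_isHermitian v p) fun x hx => ?_
  rw [star_trivial, dotProduct_momentMatrix_mulVec]
  have h0 : ∀ i ∈ Finset.univ, 0 ≤ p i * (v i ⬝ᵥ x) ^ 2 := fun i _ =>
    mul_nonneg (hp i).le (sq_nonneg _)
  refine lt_of_le_of_ne (Finset.sum_nonneg h0) fun h => hx (hv x fun i => ?_)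
  have := (Finset.sum_eq_zero_iff_of_nonneg h0).1 h.symm i (Finset.mem_univ i)
  simpa [(hp i).ne'] using this

/-- Existence of a D-optimal design, with the Kiefer–Wolfowitz optimality condition. -/
theorem exists_optimal_momentMatrix [Nonempty ι] (hn : 1 ≤ n) (v : ι → Fin n → ℝ)
    (hv : ∀ x, (∀ i, v i ⬝ᵥ x = 0) → x = 0) :
    ∃ p ∈ stdSimplex ℝ ι, (momentMatrix v p).PosDef ∧
      ∀ j, v j ⬝ᵥ ((momentMatrix v p)⁻¹ *ᵥ v j) ≤ n := by
  classical
  have hcont : Continuous fun p => (momentMatrix v p).det := by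
    refine Continuous.matrix_det ?_
    unfold momentMatrix
    fun_prop
  have hne : (stdSimplex ℝ ι).Nonempty := ⟨_, single_mem_stdSimplex ℝ (Classical.arbitrary ι)⟩
  obtain ⟨p, hp, hmax⟩ := (isCompact_stdSimplex ℝ ι).exists_isMaxOn hne hcont.continuousOn
  have hmax' : ∀ q ∈ stdSimplex ℝ ι, (momentMatrix v q).det ≤ (momentMatrix v p).det := hmax
  have hcard : (0 : ℝ) < Fintype.card ι := by exact_mod_cast Fintype.card_pos
  have hdet : 0 < (momentMatrix v p).det := by
    -- Uniform weights have positive determinant, hence so does the maximiser.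
    refine (momentMatrix_posDef (p := fun _ => (Fintype.card ι : ℝ)⁻¹) (fun _ => by positivity)
      hv).det_pos.trans_le (hmax' _ ⟨fun _ => by positivity, ?_⟩)
    simp [hcard.ne']
  have hunit : IsUnit (momentMatrix v p).det := hdet.ne'.isUnit
  refine ⟨p, hp, (momentMatrix_posSemidef v hp.1).posDef_iff_det_ne_zero.2 hdet.ne', fun j => ?_⟩
  set M := momentMatrix v p with hM
  set d := v j ⬝ᵥ (M⁻¹ *ᵥ v j) with hd
  -- Moving mass ε towards the point j is a rank-one perturbation of M; the matrix determinant lemma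
  -- compares its determinant with the maximal one.
  have key : ∀ ε : ℝ, 0 < ε → ε < 1 → (1 - ε) ^ n * (1 + ε / (1 - ε) * d) ≤ 1 := by
    intro ε h0 h1
    have h1' : 0 < 1 - ε := by linarith
    have hq := convex_stdSimplex ℝ ι hp (single_mem_stdSimplex ℝ j) h1'.le h0.le (by ring)
    have h2 := hmax' _ hq
    have h3 : momentMatrix v ((1 - ε) • p + ε • Pi.single j 1) =
        (1 - ε) • (M * (1 + replicateCol Unit ((ε / (1 - ε)) • (M⁻¹ *ᵥ v j)) *
          replicateRow Unit (v j))) := by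
      rw [Matrix.mul_add, mul_one, ← vecMulVec_eq, smul_vecMulVec, Matrix.mul_smul,
        mul_vecMulVec, mulVec_mulVec, mul_nonsing_inv _ hunit, one_mulVec, smul_add, smul_smul,
        mul_div_cancel₀ _ h1'.ne', hM]
      simp only [momentMatrix, Pi.add_apply, Pi.smul_apply, add_smul, Finset.sum_add_distrib,
        Finset.smul_sum, smul_smul, smul_eq_mul]
      congr 1
      rw [Finset.sum_eq_single j] <;> simp +contextual
    rw [h3, det_smul, det_mul, det_one_add_replicateCol_mul_replicateRow, dotProduct_smul,
      ← hd, Fintype.card_fin, smul_eq_mul] at h2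
    have h4 : M.det * ((1 - ε) ^ n * (1 + ε / (1 - ε) * d)) ≤ M.det * 1 := by linarith
    exact le_of_mul_le_mul_left h4 hdet
  obtain ⟨k, rfl⟩ : ∃ k, n = k + 1 := ⟨n - 1, by omega⟩
  have key2 : ∀ ε : ℝ, 0 < ε → ε < 1 → d ≤ (k + 1) + k * (|d| + 1) * ε := by
    intro ε h0 h1
    have h1' : 0 < 1 - ε := by linarith
    have h2 := key ε h0 h1
    have h3 : (1 - ε) ^ (k + 1) * (1 + ε / (1 - ε) * d) = (1 - ε) ^ k * (1 - ε + ε * d) := by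
      rw [pow_succ]; field_simp
    rw [h3] at h2
    have hd0 : 0 ≤ d := by
      have := ((momentMatrix_posSemidef v hp.1).posDef_iff_det_ne_zero.2
        hdet.ne').inv.posSemidef.dotProduct_mulVec_nonneg (v j)
      simpa using this
    -- Bernoulli's inequality replaces differentiation at ε = 0: the first-order term gives d ≤ k +
    -- 1 = n, up to an error linear in ε.
    have h4 : 1 - k * ε ≤ (1 - ε) ^ k := by
      have := one_add_mul_le_pow (a := -ε) (by linarith) k
      rw [← sub_eq_add_neg] at this
      linarith
    have h5 : (1 - k * ε) * (1 - ε + ε * d) ≤ 1 :=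
      (mul_le_mul_of_nonneg_right h4 (by positivity)).trans h2
    rw [abs_of_nonneg hd0]
    have h6 : 0 ≤ (k : ℝ) := by positivity
    have h7 : ε * d ≤ ε * ((k + 1) + k * (d + 1) * ε) := by
      have : 0 ≤ (k : ℝ) * ε * ε := by positivity
      nlinarith
    exact le_of_mul_le_mul_left h7 h0
  push_cast
  refine le_of_forall_pos_le_add fun δ hδ => ?_
  set B := (k : ℝ) * (|d| + 1) with hB
  have hB0 : 0 ≤ B := by positivity
  have := key2 (min (1 / 2) (δ / (B + 1))) (by positivity)
    ((min_le_left _ _).trans_lt (by norm_num))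
  refine this.trans ?_
  have h8 : B * min (1 / 2) (δ / (B + 1)) ≤ B * (δ / (B + 1)) := by
    gcongr; exact min_le_right _ _
  have h9 : B * (δ / (B + 1)) ≤ δ := by
    rw [mul_div_assoc', div_le_iff₀ (by positivity)]
    nlinarith
  linarith

end Design

/-! ### Inner ellipsoid and its volume -/

section Ellipsoid

variable {n : ℕ}

open Matrix in
/-- Weak form of John's theorem: the axes `b`, and inverse lengths `a`, of an ellipsoid which is
contained in the polar of the polar of `S ∪ -S`, and which contains `S` after dilation by `√n`. -/
theorem exists_john_ellipsoid (hn : 1 ≤ n) (S : Finset (EuclideanSpace ℝ (Fin n)))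
    (hS : ∀ x : EuclideanSpace ℝ (Fin n), (∀ s ∈ S, inner ℝ s x = 0) → x = 0) :
    ∃ (b : OrthonormalBasis (Fin n) ℝ (EuclideanSpace ℝ (Fin n))) (a : Fin n → ℝ),
      (∀ i, 0 < a i) ∧ (∀ s ∈ S, ∑ i, a i ^ 2 * (inner ℝ (b i) s) ^ 2 ≤ n) ∧
      ∀ y, ∃ s ∈ S, ∑ i, (a i ^ 2)⁻¹ * (inner ℝ (b i) y) ^ 2 ≤ (inner ℝ s y) ^ 2 := by
  have hne : Nonempty S := by
    by_contra h
    have h0 := hS (EuclideanSpace.single ⟨0, hn⟩ 1) fun s hs => absurd ⟨⟨s, hs⟩⟩ h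
    have h1 : ‖EuclideanSpace.single (⟨0, hn⟩ : Fin n) (1 : ℝ)‖ = 0 := by rw [h0, norm_zero]
    simp at h1
  have inner_eq : ∀ x y : EuclideanSpace ℝ (Fin n), inner ℝ x y = x.ofLp ⬝ᵥ y.ofLp := by
    intro x y
    rw [EuclideanSpace.inner_eq_star_dotProduct, star_trivial, dotProduct_comm]
  obtain ⟨p, hp, hM, hopt⟩ := exists_optimal_momentMatrix hn
    (fun s : S => (s : EuclideanSpace ℝ (Fin n)).ofLp) (by
      intro x hx
      have := hS (WithLp.toLp 2 x) fun s hs => by rw [inner_eq]; exact hx ⟨s, hs⟩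
      simpa using congrArg WithLp.ofLp this)
  set v : S → Fin n → ℝ := fun s : S => (s : EuclideanSpace ℝ (Fin n)).ofLp with hv
  set M := momentMatrix v p with hMdef
  set b := hM.1.eigenvectorBasis with hb
  set lam := hM.1.eigenvalues with hlam
  have hpos : ∀ i, 0 < lam i := hM.eigenvalues_pos
  have hunit : IsUnit M.det := hM.det_pos.ne'.isUnit
  have eig : ∀ i (y : EuclideanSpace ℝ (Fin n)),
      inner ℝ (b i) (WithLp.toLp 2 (M *ᵥ y.ofLp)) = lam i * inner ℝ (b i) y := by
    intro i y
    rw [inner_eq, inner_eq, dotProduct_mulVec, ← mulVec_transpose,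
      ← conjTranspose_eq_transpose_of_trivial, hM.1.eq, hM.1.mulVec_eigenvectorBasis,
      smul_dotProduct, smul_eq_mul]
  have sq : ∀ i, ((√(lam i))⁻¹) ^ 2 = (lam i)⁻¹ := fun i => by
    rw [inv_pow, Real.sq_sqrt (hpos i).le]
  -- The axes diagonalise M, so the two sums are the quadratic forms of M⁻¹ and M. The first is
  -- bounded by optimality of the design.
  refine ⟨b, fun i => (√(lam i))⁻¹, fun i => by have := hpos i; positivity, ?_, ?_⟩
  · intro s hs
    have h1 := hopt ⟨s, hs⟩
    set y : EuclideanSpace ℝ (Fin n) := WithLp.toLp 2 (M⁻¹ *ᵥ s.ofLp) with hy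
    have hys : WithLp.toLp 2 (M *ᵥ y.ofLp) = s := by
      simp [hy, mulVec_mulVec, mul_nonsing_inv _ hunit]
    have h2 : s.ofLp ⬝ᵥ (M⁻¹ *ᵥ s.ofLp) = inner ℝ s y := (inner_eq s y).symm
    rw [h2, ← b.sum_inner_mul_inner] at h1
    refine le_trans (le_of_eq (Finset.sum_congr rfl fun i _ => ?_)) h1
    have h3 := eig i y
    rw [hys] at h3
    rw [sq, real_inner_comm (b i) s, h3]
    field_simp [(hpos i).ne']
  · intro y
    -- The form of M at y is the p-average of ⟨s, y⟩², so some s attains at least the average.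
    by_contra! hcon
    have h1 : ∑ i, lam i * (inner ℝ (b i) y) ^ 2 = ∑ s : S, p s * (inner ℝ (s : EuclideanSpace ℝ (Fin n)) y) ^ 2 := by
      have h2 := dotProduct_momentMatrix_mulVec v p y.ofLp
      simp only [inner_eq _ y] at *
      rw [← h2]
      have h3 := inner_eq y (WithLp.toLp 2 (M *ᵥ y.ofLp))
      rw [← b.sum_inner_mul_inner] at h3
      simp only [eig] at h3
      rw [← h3]
      refine Finset.sum_congr rfl fun i _ => ?_
      rw [real_inner_comm, inner_eq (b i) y]
      ring
    simp only [sq, inv_inv] at hcon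
    rw [h1] at hcon
    set V := ∑ s : S, p s * (inner ℝ (s : EuclideanSpace ℝ (Fin n)) y) ^ 2 with hV
    have h4 : V < ∑ s : S, p s * V := by
      obtain ⟨s, hs⟩ : ∃ s, 0 < p s := by
        by_contra! h
        have := Finset.sum_nonpos fun s (_ : s ∈ Finset.univ) => h s
        rw [hp.2] at this
        linarith
      exact Finset.sum_lt_sum
        (fun s _ => mul_le_mul_of_nonneg_left (hcon s s.2).le (hp.1 s))
        ⟨s, Finset.mem_univ _, mul_lt_mul_of_pos_left (hcon s s.2) hs⟩
    rw [← Finset.sum_mul, hp.2, one_mul] at h4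
    exact lt_irrefl _ h4

/-- Volume of a box with respect to an orthonormal basis. -/
theorem OrthonormalBasis.volume_box (b : OrthonormalBasis (Fin n) ℝ (EuclideanSpace ℝ (Fin n)))
    (r : Fin n → ℝ) (hr : ∀ i, 0 ≤ r i) :
    volume {x | ∀ i, |inner ℝ (b i) x| ≤ r i} = ENNReal.ofReal (∏ i, (2 * r i)) := by
  have h1 : {x | ∀ i, |inner ℝ (b i) x| ≤ r i} =
      b.repr ⁻¹' (WithLp.ofLp ⁻¹' (Set.Icc (fun i => -r i) r)) := by
    ext x
    simp [abs_le, Pi.le_def, forall_and, OrthonormalBasis.repr_apply_apply]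
  have hm : MeasurableSet (Set.Icc (fun i => -r i) r) := measurableSet_Icc
  rw [h1, b.measurePreserving_repr.measure_preimage
      ((PiLp.volume_preserving_ofLp (Fin n)).measurable hm).nullMeasurableSet,
    (PiLp.volume_preserving_ofLp (Fin n)).measure_preimage hm.nullMeasurableSet,
    Real.volume_Icc_pi, ← ENNReal.ofReal_prod_of_nonneg]
  · congr 2
    ext i
    ring
  · intro i _
    have := hr i
    linarith

/-- Separation and Cauchy–Schwarz put the ellipsoid inside K. A box with half-sides `(a i * √n)⁻¹`
fits in the ellipsoid and so has volume at most one; this bounds the product of the `a i` below, and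
AM–GM bounds their sum. -/
theorem two_mul_sqrt_le_sum (hn : 1 ≤ n) {K : Set (EuclideanSpace ℝ (Fin n))}
    (hconv : Convex ℝ K) (hc : IsCompact K) (hv : volume K = 1)
    (S : Finset (EuclideanSpace ℝ (Fin n))) (hSK : ∀ s ∈ S, s ∈ K ∧ -s ∈ K)
    (b : OrthonormalBasis (Fin n) ℝ (EuclideanSpace ℝ (Fin n))) (a : Fin n → ℝ)
    (ha : ∀ i, 0 < a i)
    (h : ∀ y, ∃ s ∈ S, ∑ i, (a i ^ 2)⁻¹ * (inner ℝ (b i) y) ^ 2 ≤ (inner ℝ s y) ^ 2) :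
    2 * √n ≤ ∑ i, a i := by
  have hn0 : (0 : ℝ) < n := by exact_mod_cast hn
  have hsn : 0 < √(n : ℝ) := Real.sqrt_pos.2 hn0
  have ellipsoid : ∀ x, ∑ i, a i ^ 2 * (inner ℝ (b i) x) ^ 2 ≤ 1 → x ∈ K := by
    intro x hx
    by_contra hxK
    obtain ⟨f, u, hfu, hux⟩ := geometric_hahn_banach_closed_point hconv hc.isClosed hxK
    set y := (InnerProductSpace.toDual ℝ _).symm f with hy
    have hf : ∀ z, f z = inner ℝ z y := fun z => by
      rw [real_inner_comm, hy, InnerProductSpace.toDual_symm_apply]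
    obtain ⟨s, hs, hle⟩ := h y
    have h1 := hfu s (hSK s hs).1
    have h2 := hfu (-s) (hSK s hs).2
    rw [hf] at h1 h2 hux
    rw [inner_neg_left] at h2
    have h3 : (inner ℝ s y) ^ 2 < (inner ℝ x y) ^ 2 := sq_lt_sq' (by linarith) (by linarith)
    have h4 : (inner ℝ x y) ^ 2 ≤ (∑ i, a i ^ 2 * (inner ℝ (b i) x) ^ 2) *
        ∑ i, (a i ^ 2)⁻¹ * (inner ℝ (b i) y) ^ 2 := by
      rw [← b.sum_inner_mul_inner]
      refine Finset.sum_sq_le_sum_mul_sum_of_sq_le_mul _ (fun i _ => by positivity)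
        (fun i _ => by positivity) fun i _ => ?_
      have := (ha i).ne'
      rw [real_inner_comm (b i) x]
      refine le_of_eq ?_
      field_simp
    have h5 : 0 ≤ ∑ i, (a i ^ 2)⁻¹ * (inner ℝ (b i) y) ^ 2 :=
      Finset.sum_nonneg fun i _ => by positivity
    nlinarith
  have box : {x | ∀ i, |inner ℝ (b i) x| ≤ (a i * √n)⁻¹} ⊆ K := by
    intro x hx
    apply ellipsoid
    calc ∑ i, a i ^ 2 * (inner ℝ (b i) x) ^ 2 ≤ ∑ i : Fin n, (n : ℝ)⁻¹ := by
          refine Finset.sum_le_sum fun i _ => ?_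
          have h1 : (inner ℝ (b i) x) ^ 2 ≤ ((a i * √n)⁻¹) ^ 2 := by
            rw [← sq_abs]
            exact pow_le_pow_left₀ (abs_nonneg _) (hx i) 2
          rw [inv_pow, mul_pow, Real.sq_sqrt hn0.le] at h1
          have h2 := ha i
          refine (mul_le_mul_of_nonneg_left h1 (by positivity)).trans (le_of_eq ?_)
          field_simp
      _ = 1 := by simp [hn0.ne']
  have hvol := measure_mono (μ := volume) box
  rw [b.volume_box _ (fun i => by have := ha i; positivity), hv, ENNReal.ofReal_le_one] at hvol
  have hprod : (2 / √n) ^ n ≤ ∏ i, a i := by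
    have h1 : ∏ i, (2 * (a i * √n)⁻¹) = (2 / √n) ^ n * (∏ i, a i)⁻¹ := by
      rw [← Finset.prod_inv_distrib]
      have : (2 / √(n : ℝ)) ^ n = ∏ i : Fin n, (2 / √(n : ℝ)) := by
        rw [Finset.prod_const, Finset.card_univ, Fintype.card_fin]
      rw [this, ← Finset.prod_mul_distrib]
      refine Finset.prod_congr rfl fun i _ => ?_
      rw [mul_inv]
      ring
    rw [h1, ← div_eq_mul_inv, div_le_one (Finset.prod_pos fun i _ => ha i)] at hvol
    exact hvol
  have amgm := Real.geom_mean_le_arith_mean Finset.univ (fun _ : Fin n => (1 : ℝ)) a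
    (by simp) (by simpa using hn0) (fun i _ => (ha i).le)
  simp only [Real.rpow_one, Finset.sum_const, Finset.card_univ, Fintype.card_fin, nsmul_eq_mul,
    mul_one, one_mul] at amgm
  have h2 : 2 / √(n : ℝ) ≤ (∏ i, a i) ^ ((n : ℝ)⁻¹) := by
    rw [Real.le_rpow_inv_iff_of_pos (by positivity) (Finset.prod_pos fun i _ => ha i).le hn0,
      Real.rpow_natCast]
    exact hprod
  have h3 := h2.trans amgm
  rw [le_div_iff₀ hn0] at h3
  have h4 : 2 / √(n : ℝ) * n = 2 * √n := by
    nth_rewrite 2 [← Real.mul_self_sqrt hn0.le]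
    field_simp
  linarith

end Ellipsoid

/-! ### Isotropic position: the bound for hulls of points -/

section Isotropic

variable {n : ℕ} {K : Set (EuclideanSpace ℝ (Fin n))} {L : ℝ}

theorem IsIsotropicWith.setIntegral_inner_sq (h : IsIsotropicWith K L)
    (θ : EuclideanSpace ℝ (Fin n)) : ∫ x in K, (inner ℝ x θ) ^ 2 = L ^ 2 * ‖θ‖ ^ 2 := by
  by_cases hθ : θ = 0
  · simp [hθ]
  have h1 := h.2.2 (‖θ‖⁻¹ • θ) (by simp [norm_smul, hθ])
  have h2 : ‖θ‖ ≠ 0 := by simpa using hθ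
  rw [← h1, ← integral_mul_const]
  refine integral_congr_ae (Filter.Eventually.of_forall fun x => ?_)
  simp only [inner_smul_right]
  field_simp

/-- The integral of ⟨x, Tx⟩ is evaluated exactly by isotropy and bounded above by the maximal
inequality applied to the points Ts. -/
theorem IsIsotropicWith.le_log_card (hn : 1 ≤ n) (h : IsIsotropicWith K L)
    (hs : ∀ x ∈ K, -x ∈ K) (S : Finset (EuclideanSpace ℝ (Fin n)))
    (hK : K = convexHull ℝ (S : Set (EuclideanSpace ℝ (Fin n)))) :
    L ≤ 4 * (Real.log S.card + 4) := by
  classical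
  have hconv : Convex ℝ K := hK ▸ convex_convexHull ℝ _
  have hc : IsCompact K := by rw [hK]; exact S.finite_toSet.isCompact_convexHull ℝ
  have hn0 : (0 : ℝ) < n := by exact_mod_cast hn
  have hne : S.Nonempty := by
    rw [Finset.nonempty_iff_ne_empty]
    rintro rfl
    have := h.1
    simp [hK] at this
  have hlog : 0 ≤ Real.log S.card := Real.log_natCast_nonneg _
  rcases h.2.1.eq_or_lt with rfl | hL
  · positivity
  have hSK : ∀ s ∈ S, s ∈ K ∧ -s ∈ K := fun s hsS => by
    have : s ∈ K := hK ▸ subset_convexHull ℝ _ hsS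
    exact ⟨this, hs s this⟩
  -- Otherwise K lies in a hyperplane and has a vanishing second moment, against L > 0.
  have hspan : ∀ x : EuclideanSpace ℝ (Fin n), (∀ s ∈ S, inner ℝ s x = 0) → x = 0 := by
    intro x hx
    have h1 : K ⊆ {y | inner ℝ y x = 0} := by
      rw [hK]
      refine convexHull_min (fun s hsS => hx s hsS) ?_
      intro a (ha : inner ℝ a x = 0) b (hb : inner ℝ b x = 0) p q _ _ _
      simp [inner_add_left, inner_smul_left, ha, hb]
    have h2 := h.setIntegral_inner_sq x
    rw [setIntegral_congr_fun (g := fun _ => (0 : ℝ)) hc.measurableSet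
      (fun y hy => by simp [Set.mem_ofPred_eq.mp (h1 hy)])] at h2
    simpa [hL.ne'] using h2.symm
  obtain ⟨b, a, ha, hle, hge⟩ := exists_john_ellipsoid hn S hspan
  have hsum := two_mul_sqrt_le_sum hn hconv hc h.1 S hSK b a ha hge
  have hsn : 0 < √(n : ℝ) := Real.sqrt_pos.2 hn0
  set T : EuclideanSpace ℝ (Fin n) → EuclideanSpace ℝ (Fin n) :=
    fun s => ∑ i, (a i * inner ℝ (b i) s) • b i with hT
  have hTb : ∀ s i, inner ℝ (b i) (T s) = a i * inner ℝ (b i) s := fun s i => by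
    rw [hT, b.orthonormal.inner_right_fintype]
  have hTin : ∀ x s, inner ℝ x (T s) = ∑ i, a i * (inner ℝ (b i) s * inner ℝ (b i) x) := by
    intro x s
    rw [← b.sum_inner_mul_inner]
    refine Finset.sum_congr rfl fun i _ => ?_
    rw [hTb, real_inner_comm (b i) x]
    ring
  have hTnorm : ∀ s ∈ S, ‖T s‖ ^ 2 ≤ n := by
    intro s hsS
    refine le_trans (le_of_eq ?_) (hle s hsS)
    rw [← real_inner_self_eq_norm_sq, ← b.sum_inner_mul_inner]
    refine Finset.sum_congr rfl fun i _ => ?_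
    rw [real_inner_comm (b i) (T s), hTb]
    ring
  have hmain := setIntegral_le_of_le_abs_inner hconv hc hs h.1 (σ := L * √n) (by positivity)
    (S := S.image T) (hne.image T) (Φ := fun x => inner ℝ x (T x)) ?_ ?_ ?_
  · have h1 : ∫ x in K, inner ℝ x (T x) = L ^ 2 * ∑ i, a i := by
      simp only [hTin]
      rw [integral_finsetSum _ fun i _ => ContinuousOn.integrableOn_compact hc (by fun_prop),
        Finset.mul_sum]
      refine Finset.sum_congr rfl fun i _ => ?_
      rw [integral_const_mul]
      have h2 := h.setIntegral_inner_sq (b i)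
      rw [b.norm_eq_one, one_pow, mul_one] at h2
      rw [← h2, mul_comm]
      congr 1
      refine integral_congr_ae (Filter.Eventually.of_forall fun x => ?_)
      simp only [real_inner_comm (b i) x]
      ring
    rw [h1] at hmain
    have h3 : Real.log (S.image T).card ≤ Real.log S.card := by
      apply Real.log_le_log
      · exact_mod_cast (hne.image T).card_pos
      · exact_mod_cast Finset.card_image_le
    have h4 : L ^ 2 * (2 * √n) ≤ 8 * (L * √n) * (Real.log S.card + 4) := by
      refine ((mul_le_mul_of_nonneg_left hsum (by positivity)).trans hmain).trans ?_
      gcongr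
    have h5 : (L * √n) * (2 * L) ≤ (L * √n) * (8 * (Real.log S.card + 4)) := by linarith
    have h6 := le_of_mul_le_mul_left h5 (by positivity)
    linarith
  · intro w hw
    obtain ⟨s, hsS, rfl⟩ := Finset.mem_image.1 hw
    rw [h.setIntegral_inner_sq, mul_pow, Real.sq_sqrt hn0.le]
    gcongr
    exact hTnorm s hsS
  · simp only [hTin]
    exact ContinuousOn.integrableOn_compact hc (by fun_prop)
  · intro x hx
    -- For fixed Tx, a linear functional on the hull is at most its maximum over S; T is symmetric,
    -- so it can then be moved onto s.
    have h1 : ∃ s ∈ S, inner ℝ x (T x) ≤ inner ℝ s (T x) := by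
      by_contra! hcon
      have h2 : K ⊆ {y | inner ℝ y (T x) < inner ℝ x (T x)} := by
        rw [hK]
        refine convexHull_min (fun s hsS => hcon s hsS) ?_
        exact convex_halfSpace_lt
          ⟨fun a b => inner_add_left _ _ _, fun c a => by simp [inner_smul_left]⟩ _
      exact lt_irrefl (inner ℝ x (T x)) (h2 hx)
    obtain ⟨s, hsS, hle'⟩ := h1
    refine ⟨T s, Finset.mem_image_of_mem T hsS, hle'.trans (le_trans (le_of_eq ?_) (le_abs_self _))⟩
    rw [hTin, hTin]
    refine Finset.sum_congr rfl fun i _ => ?_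
    ring

/-! ### The Gaussian bound for intersections of half-spaces -/

theorem EuclideanSpace.integral_exp_neg_pi_mul_sq_norm :
    ∫ x : EuclideanSpace ℝ (Fin n), Real.exp (-Real.pi * ‖x‖ ^ 2) = 1 := by
  rw [GaussianFourier.integral_rexp_neg_mul_sq_norm Real.pi_pos, div_self Real.pi_ne_zero,
    Real.one_rpow]

theorem EuclideanSpace.integrable_exp_neg_pi_mul_sq_norm :
    Integrable fun x : EuclideanSpace ℝ (Fin n) => Real.exp (-Real.pi * ‖x‖ ^ 2) := by
  by_contra h
  have h1 := EuclideanSpace.integral_exp_neg_pi_mul_sq_norm (n := n)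
  rw [integral_undef h] at h1
  exact zero_ne_one h1

/-- With a the point of the bounding hyperplane nearest to 0, ‖x‖² ≥ ‖a‖² + ‖x - a‖² on the
half-space; the translated Gaussian has total mass one. -/
theorem EuclideanSpace.gaussian_halfspace_le {y : EuclideanSpace ℝ (Fin n)} (hy : y ≠ 0) {t : ℝ}
    (ht : 0 ≤ t) :
    ∫ x in {x | t < inner ℝ x y}, Real.exp (-Real.pi * ‖x‖ ^ 2) ≤
      Real.exp (-Real.pi * (t / ‖y‖) ^ 2) := by
  have hy0 : 0 < ‖y‖ := norm_pos_iff.2 hy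
  set a := (t / ‖y‖ ^ 2) • y with ha
  have hm : MeasurableSet {x : EuclideanSpace ℝ (Fin n) | t < inner ℝ x y} :=
    measurableSet_lt measurable_const (by fun_prop)
  have hna : ‖a‖ = t / ‖y‖ := by
    rw [ha, norm_smul, Real.norm_of_nonneg (by positivity)]
    field_simp
  have hint := EuclideanSpace.integrable_exp_neg_pi_mul_sq_norm (n := n)
  have hint2 : Integrable fun x : EuclideanSpace ℝ (Fin n) =>
      Real.exp (-Real.pi * (t / ‖y‖) ^ 2) * Real.exp (-Real.pi * ‖x - a‖ ^ 2) :=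
    (hint.comp_sub_right a).const_mul _
  calc _ ≤ ∫ x in {x | t < inner ℝ x y},
        Real.exp (-Real.pi * (t / ‖y‖) ^ 2) * Real.exp (-Real.pi * ‖x - a‖ ^ 2) := by
        refine setIntegral_mono_on hint.integrableOn hint2.integrableOn hm ?_
        intro x (hx : t < inner ℝ x y)
        rw [← Real.exp_add, Real.exp_le_exp, ← hna]
        have h1 : ‖x - a‖ ^ 2 = ‖x‖ ^ 2 - 2 * inner ℝ x a + ‖a‖ ^ 2 := norm_sub_sq_real x a
        have h2 : ‖a‖ ^ 2 ≤ inner ℝ x a := by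
          rw [hna, ha, inner_smul_right, div_pow, div_mul_eq_mul_div]
          gcongr
          nlinarith
        nlinarith [Real.pi_pos]
    _ ≤ ∫ x, Real.exp (-Real.pi * (t / ‖y‖) ^ 2) * Real.exp (-Real.pi * ‖x - a‖ ^ 2) :=
        setIntegral_le_integral hint2 (Filter.Eventually.of_forall fun x => by positivity)
    _ = _ := by
        rw [integral_const_mul,
          integral_sub_right_eq_self (fun x => Real.exp (-Real.pi * ‖x‖ ^ 2)) a,
          EuclideanSpace.integral_exp_neg_pi_mul_sq_norm, mul_one]

open scoped Pointwise in
/-- The isotropic constant of a symmetric intersection of `N` half-spaces is `O(√log N)`. -/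
theorem IsIsotropicWith.sq_le_log_card (hn : 1 ≤ n) (h : IsIsotropicWith K L) (hc : IsCompact K)
    (hs : ∀ x ∈ K, -x ∈ K) (E : Finset (EuclideanSpace ℝ (Fin n)))
    (hK : K = {x | ∀ y ∈ E, inner ℝ x y ≤ 1}) :
    L ^ 2 ≤ 4 * Real.log (2 * E.card) := by
  set G : EuclideanSpace ℝ (Fin n) → ℝ := fun x => Real.exp (-Real.pi * ‖x‖ ^ 2) with hG
  have hG0 : ∀ x, 0 ≤ G x := fun x => (Real.exp_pos _).le
  have hG1 : ∀ x, G x ≤ 1 := fun x => by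
    refine Real.exp_le_one_iff.2 ?_
    nlinarith [Real.pi_pos, sq_nonneg ‖x‖]
  have hGi : Integrable G := EuclideanSpace.integrable_exp_neg_pi_mul_sq_norm
  have hbound : ∀ y ∈ E, L ^ 2 * ‖y‖ ^ 2 ≤ 1 := by
    intro y hy
    rw [← h.setIntegral_inner_sq]
    have h1 : ∫ x in K, (inner ℝ x y) ^ 2 ≤ ∫ x in K, (1 : ℝ) := by
      refine setIntegral_mono_on (ContinuousOn.integrableOn_compact hc (by fun_prop))
        (by simp [h.1]) hc.measurableSet fun x hx => ?_
      have h2 := hs x hx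
      rw [hK] at hx h2
      have h3 := h2 y hy
      rw [inner_neg_left] at h3
      have h4 := hx y hy
      nlinarith
    simpa [measureReal_def, h.1] using h1
  have hhalf : ∀ y ∈ E, ∫ x in {x | 1 / 2 < inner ℝ x y}, G x ≤
      Real.exp (-Real.pi * L ^ 2 / 4) := by
    intro y hy
    by_cases hy0 : y = 0
    · simp only [hy0, inner_zero_right]
      norm_num
      positivity
    · refine (EuclideanSpace.gaussian_halfspace_le hy0 (by norm_num)).trans ?_
      have h1 := hbound y hy
      have h2 : 0 < ‖y‖ := norm_pos_iff.2 hy0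
      rw [Real.exp_le_exp, div_pow]
      have h3 : L ^ 2 ≤ 1 / ‖y‖ ^ 2 := by rwa [le_div_iff₀ (by positivity)]
      have h4 : (1 / 2) ^ 2 / ‖y‖ ^ 2 = (1 / ‖y‖ ^ 2) / 4 := by ring
      rw [h4]
      nlinarith [Real.pi_pos]
  -- Halving K leaves volume 2⁻ⁿ ≤ 1/2, so at least half of the Gaussian mass lies outside Q.
  set Q : Set (EuclideanSpace ℝ (Fin n)) := (2⁻¹ : ℝ) • K with hQ
  have hQm : MeasurableSet Q := (hc.smul _).measurableSet
  have hQv : volume.real Q ≤ 1 / 2 := by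
    rw [measureReal_def, hQ, Measure.addHaar_smul, h.1]
    simp only [finrank_euclideanSpace, Fintype.card_fin, mul_one]
    rw [ENNReal.toReal_ofReal (abs_nonneg _), abs_of_nonneg (by positivity)]
    calc (2⁻¹ : ℝ) ^ n ≤ 2⁻¹ ^ 1 := pow_le_pow_of_le_one (by norm_num) (by norm_num) hn
      _ = 1 / 2 := by norm_num
  have hQf : volume Q ≠ ⊤ := (hc.smul _).measure_lt_top.ne
  have hQmem : ∀ x, x ∉ Q → ∃ y ∈ E, 1 / 2 < inner ℝ x y := by
    intro x hx
    by_contra! hcon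
    refine hx ((Set.mem_smul_set_iff_inv_smul_mem₀ (by norm_num) _ _).2 ?_)
    rw [hK]
    intro y hy
    have := hcon y hy
    rw [inner_smul_left]
    simp only [inv_inv, conj_trivial]
    linarith
  have hHm : ∀ y : EuclideanSpace ℝ (Fin n),
      MeasurableSet {x : EuclideanSpace ℝ (Fin n) | 1 / 2 < inner ℝ x y} := fun y =>
    measurableSet_lt measurable_const (by fun_prop)
  have total : 1 ≤ 1 / 2 + E.card * Real.exp (-Real.pi * L ^ 2 / 4) := by
    calc (1 : ℝ) = ∫ x, G x := EuclideanSpace.integral_exp_neg_pi_mul_sq_norm.symm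
      _ ≤ ∫ x, (Q.indicator G x + ∑ y ∈ E, {x | 1 / 2 < inner ℝ x y}.indicator G x) := by
          refine integral_mono hGi ((hGi.indicator hQm).add
            (integrable_finsetSum _ fun y _ => hGi.indicator (hHm y))) fun x => ?_
          have h0 : ∀ y ∈ E, 0 ≤ {x | 1 / 2 < inner ℝ x y}.indicator G x := fun y _ =>
            Set.indicator_nonneg (fun x _ => hG0 x) x
          by_cases hx : x ∈ Q
          · simp only [Set.indicator_of_mem hx]
            have := Finset.sum_nonneg h0
            linarith
          · obtain ⟨y, hy, hxy⟩ := hQmem x hx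
            have h1 := Finset.single_le_sum h0 hy
            rw [Set.indicator_of_mem (by exact hxy)] at h1
            simpa [Set.indicator_of_notMem hx] using h1
      _ = (∫ x in Q, G x) + ∑ y ∈ E, ∫ x in {x | 1 / 2 < inner ℝ x y}, G x := by
          rw [integral_add (hGi.indicator hQm)
            (integrable_finsetSum _ fun y _ => hGi.indicator (hHm y)),
            integral_finsetSum _ fun y _ => hGi.indicator (hHm y), integral_indicator hQm]
          simp only [integral_indicator (hHm _)]
      _ ≤ 1 / 2 + ∑ y ∈ E, Real.exp (-Real.pi * L ^ 2 / 4) := by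
          refine add_le_add (le_trans ?_ hQv) (Finset.sum_le_sum hhalf)
          have h1 := setIntegral_mono_on (μ := volume) hGi.integrableOn (g := fun _ => (1 : ℝ))
            (by simpa using hQf.lt_top) hQm fun x _ => hG1 x
          simpa using h1
      _ = _ := by rw [Finset.sum_const, nsmul_eq_mul]
  have hN : (0 : ℝ) < E.card := by
    by_contra! hcon
    have h1 : (E.card : ℝ) = 0 := le_antisymm hcon (by positivity)
    rw [h1] at total
    norm_num at total
  have h1 : Real.exp (Real.pi * L ^ 2 / 4) ≤ 2 * E.card := by
    have h2 : -Real.pi * L ^ 2 / 4 = -(Real.pi * L ^ 2 / 4) := by ring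
    rw [h2, Real.exp_neg] at total
    have h3 : 1 / 2 ≤ E.card * (Real.exp (Real.pi * L ^ 2 / 4))⁻¹ := by linarith
    rw [← div_eq_mul_inv, le_div_iff₀ (Real.exp_pos _)] at h3
    linarith
  have h4 := (Real.le_log_iff_exp_le (by positivity)).2 h1
  nlinarith [Real.pi_gt_three, sq_nonneg L]

end Isotropic

/-! ### Facets and the polar body -/

section Facets

variable {n : ℕ}

theorem IsSymmConvexBody.zero_mem_interior {K : Set (EuclideanSpace ℝ (Fin n))}
    (h : IsSymmConvexBody K) : (0 : EuclideanSpace ℝ (Fin n)) ∈ interior K := by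
  obtain ⟨x, hx⟩ := h.interior_nonempty
  have := h.convex.combo_interior_self_mem_interior hx (h.neg_mem x (interior_subset hx))
    (a := 1 / 2) (b := 1 / 2) (by norm_num) (by norm_num) (by norm_num)
  simpa using this

/-- If the active constraints did not span, y could be moved both ways along a vector orthogonal to
all of them: active constraints stay equalities, and the finitely many others have slack. -/
theorem span_active_eq_top {S : Set (EuclideanSpace ℝ (Fin n))} (hS : S.Finite)
    {y : EuclideanSpace ℝ (Fin n)}
    (hy : y ∈ Set.extremePoints ℝ {y : EuclideanSpace ℝ (Fin n) | ∀ s ∈ S, inner ℝ s y ≤ 1}) :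
    Submodule.span ℝ {s ∈ S | inner ℝ s y = 1} = ⊤ := by
  by_contra hne
  obtain ⟨v, hv, hv0⟩ := Submodule.exists_mem_ne_zero_of_ne_bot
    (mt Submodule.orthogonal_eq_bot_iff.1 hne)
  have hev : ∀ᶠ c : ℝ in nhds 0, ∀ s ∈ S, inner ℝ s (y + c • v) ≤ 1 ∧ inner ℝ s (y - c • v) ≤ 1 := by
    refine (Filter.eventually_all_finite hS).2 fun s hs => ?_
    rcases (hy.1 s hs).eq_or_lt with h | h
    · have : inner ℝ s v = 0 := hv s (Submodule.subset_span ⟨hs, h⟩)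
      refine Filter.Eventually.of_forall fun c => ?_
      simp [inner_add_right, inner_sub_right, inner_smul_right, this, h]
    · have h1 : Filter.Tendsto (fun c : ℝ => inner ℝ s (y + c • v)) (nhds 0)
          (nhds (inner ℝ s (y + (0 : ℝ) • v))) := Continuous.tendsto (by fun_prop) 0
      have h2 : Filter.Tendsto (fun c : ℝ => inner ℝ s (y - c • v)) (nhds 0)
          (nhds (inner ℝ s (y - (0 : ℝ) • v))) := Continuous.tendsto (by fun_prop) 0
      filter_upwards [h1.eventually_lt_const (by simpa using h),
        h2.eventually_lt_const (by simpa using h)] with c hc1 hc2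
      exact ⟨hc1.le, hc2.le⟩
  obtain ⟨c, hc, hc0⟩ := ((hev.filter_mono nhdsWithin_le_nhds).and
    (self_mem_nhdsWithin : {0}ᶜ ∈ nhdsWithin (0 : ℝ) {0}ᶜ)).exists
  have h3 := hy.2 (x₁ := y + c • v) (fun s hs => (hc s hs).1) (x₂ := y - c • v)
    (fun s hs => (hc s hs).2)
    ⟨1 / 2, 1 / 2, by norm_num, by norm_num, by norm_num, by module⟩
  have h4 : c • v = 0 := by simpa using h3
  rcases smul_eq_zero.1 h4 with h | h
  · exact hc0 h
  · exact hv0 h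

/-- A polytope is the intersection of the half-spaces defined by its facets. -/
theorem IsSymmPolytope.exists_halfSpaces {P : Set (EuclideanSpace ℝ (Fin n))} (hn : 1 ≤ n)
    (hP : IsSymmPolytope P) {N : ℕ} (hN : (facets P).encard = N) :
    ∃ E : Finset (EuclideanSpace ℝ (Fin n)), E.card ≤ N ∧
      P = {x | ∀ y ∈ E, inner ℝ x y ≤ 1} := by
  obtain ⟨hbody, S, hS, hPS⟩ := hP
  -- Q is the polar of P, compact because 0 is interior to P. Its extreme points inject into the
  -- facets of P, and they are the normals sought.
  set Q : Set (EuclideanSpace ℝ (Fin n)) := {y | ∀ s ∈ S, inner ℝ s y ≤ 1} with hQ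
  have hSP : ∀ s ∈ S, s ∈ P := fun s hs => hPS ▸ subset_convexHull ℝ S hs
  have hQP : ∀ y ∈ Q, ∀ x ∈ P, inner ℝ x y ≤ 1 := by
    intro y hy x hx
    rw [hPS] at hx
    exact convexHull_min (t := {x | inner ℝ x y ≤ 1}) (fun s hs => hy s hs)
      (convex_halfSpace_le ⟨fun a b => inner_add_left _ _ _,
        fun c a => by simp [inner_smul_left]⟩ _) hx
  have h0P := hbody.zero_mem_interior
  have hQconv : Convex ℝ Q := by
    intro a ha b hb p q hp hq hpq s hs
    rw [inner_add_right, inner_smul_right, inner_smul_right]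
    have h1 := ha s hs
    have h2 := hb s hs
    nlinarith
  have hQclosed : IsClosed Q := by
    have : Q = ⋂ s ∈ S, {y | inner ℝ s y ≤ 1} := by ext; simp [hQ]
    rw [this]
    exact isClosed_biInter fun s _ => isClosed_le (by fun_prop) continuous_const
  have hQc : IsCompact Q := by
    obtain ⟨r, hr, hball⟩ := Metric.mem_nhds_iff.1 (mem_interior_iff_mem_nhds.1 h0P)
    refine (isCompact_closedBall 0 (2 / r)).of_isClosed_subset hQclosed fun y hy => ?_
    rw [mem_closedBall_zero_iff, le_div_iff₀ hr]
    by_cases hy0 : y = 0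
    · simp [hy0]
    have hy1 : 0 < ‖y‖ := norm_pos_iff.2 hy0
    have h1 := hQP y hy ((r / 2 / ‖y‖) • y) (hball (by
      rw [mem_ball_zero_iff, norm_smul, Real.norm_of_nonneg (by positivity),
        div_mul_cancel₀ _ hy1.ne']
      linarith))
    rw [real_inner_smul_left, real_inner_self_eq_norm_sq] at h1
    have h2 : r / 2 / ‖y‖ * ‖y‖ ^ 2 = r / 2 * ‖y‖ := by field_simp
    linarith
  set F : EuclideanSpace ℝ (Fin n) → Set (EuclideanSpace ℝ (Fin n)) :=
    fun y => {x ∈ P | inner ℝ x y = 1} with hF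
  have hFmem : ∀ y ∈ Q.extremePoints ℝ, F y ∈ facets P := by
    intro y hy
    have hspan := span_active_eq_top hS hy
    have hne : {s ∈ S | inner ℝ s y = 1}.Nonempty := by
      rw [Set.nonempty_iff_ne_empty]
      intro h
      rw [h, Submodule.span_empty] at hspan
      have h1 := finrank_bot ℝ (EuclideanSpace ℝ (Fin n))
      rw [hspan, finrank_top, finrank_euclideanSpace, Fintype.card_fin] at h1
      omega
    obtain ⟨a₀, ha₀, ha₀y⟩ := hne
    have ha₀F : a₀ ∈ F y := ⟨hSP a₀ ha₀, ha₀y⟩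
    refine ⟨⟨a₀, ha₀F⟩, ?_, ?_⟩
    · intro _
      refine ⟨innerSL ℝ y, ?_⟩
      ext x
      simp only [hF, Set.mem_ofPred_eq, innerSL_apply_apply, real_inner_comm _ y]
      refine and_congr_right fun hx => ⟨fun h z hz => h ▸ hQP y hy.1 z hz, fun h => ?_⟩
      exact le_antisymm (hQP y hy.1 x hx) (ha₀y ▸ h a₀ (hSP a₀ ha₀))
    · set V := vectorSpan ℝ (F y) with hV
      have hVy : ∀ v ∈ V, inner ℝ v y = 0 := by
        intro v hv
        rw [hV, vectorSpan_def] at hv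
        induction hv using Submodule.span_induction with
        | mem v hv =>
          obtain ⟨p, hp, q, hq, rfl⟩ := hv
          simp only [vsub_eq_sub, inner_sub_left, hp.2, hq.2, sub_self]
        | zero => simp
        | add a b _ _ ha hb => rw [inner_add_left, ha, hb, add_zero]
        | smul c a _ ha => rw [real_inner_smul_left, ha, mul_zero]
      have hlt : Module.finrank ℝ V < n := by
        have := Submodule.finrank_lt (s := V) (by
          intro h
          have h1 := hVy a₀ (h ▸ Submodule.mem_top)
          rw [ha₀y] at h1
          exact one_ne_zero h1)
        simpa using this
      -- The active points span, and differ from `a₀` by elements of V; hence V has codimension at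
      -- most one, and exactly one since it is orthogonal to y.
      have htop : V ⊔ Submodule.span ℝ {a₀} = ⊤ := by
        rw [eq_top_iff, ← hspan, Submodule.span_le]
        rintro s ⟨hs, hsy⟩
        have h1 : s - a₀ ∈ V := vsub_mem_vectorSpan ℝ (show s ∈ F y from ⟨hSP s hs, hsy⟩) ha₀F
        have h2 := Submodule.add_mem_sup h1 (Submodule.mem_span_singleton_self a₀)
        simpa using h2
      have hge := Submodule.finrank_add_le_finrank_add_finrank V (Submodule.span ℝ {a₀})
      rw [htop, finrank_top, finrank_euclideanSpace, Fintype.card_fin] at hge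
      have h3 : Module.finrank ℝ (Submodule.span ℝ {a₀}) = 1 := finrank_span_singleton (by
        rintro rfl
        simp at ha₀y)
      omega
  have hFinj : Set.InjOn F (Q.extremePoints ℝ) := by
    intro y hy y' hy' hyy
    have hspan := span_active_eq_top hS hy
    have h1 : y - y' ∈ (Submodule.span ℝ {s ∈ S | inner ℝ s y = 1})ᗮ := by
      rw [Submodule.mem_orthogonal]
      intro u hu
      induction hu using Submodule.span_induction with
      | mem s hs =>
        have h2 : s ∈ F y' := hyy ▸ ⟨hSP s hs.1, hs.2⟩
        rw [inner_sub_right, hs.2, h2.2, sub_self]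
      | zero => simp
      | add a b _ _ ha hb => rw [inner_add_left, ha, hb, add_zero]
      | smul c a _ ha => rw [real_inner_smul_left, ha, mul_zero]
    rw [hspan, Submodule.top_orthogonal_eq_bot, Submodule.mem_bot, sub_eq_zero] at h1
    exact h1
  have hcard : (Q.extremePoints ℝ).encard ≤ N := by
    rw [← hN, ← hFinj.encard_image]
    exact Set.encard_le_encard (Set.image_subset_iff.2 hFmem)
  have hfin : (Q.extremePoints ℝ).Finite := Set.finite_of_encard_le_coe hcard
  refine ⟨hfin.toFinset, ?_, ?_⟩
  · rw [hfin.encard_eq_coe_toFinset_card] at hcard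
    exact_mod_cast hcard
  · ext x
    simp only [Set.Finite.mem_toFinset, Set.mem_ofPred_eq]
    refine ⟨fun hx y hy => hQP y hy.1 x hx, fun hx => ?_⟩
    -- Krein–Milman passes from the extreme points to all of Q; the separation below is the bipolar
    -- theorem.
    have hxQ : ∀ y ∈ Q, inner ℝ x y ≤ 1 := by
      intro y hy
      rw [← closure_convexHull_extremePoints hQc hQconv] at hy
      refine closure_minimal (t := {y | inner ℝ x y ≤ 1}) (convexHull_min (fun y hy => hx y hy) ?_)
        (isClosed_le (by fun_prop) continuous_const) hy
      exact convex_halfSpace_le ⟨fun a b => inner_add_right _ _ _,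
        fun c a => by simp [inner_smul_right]⟩ _
    by_contra hxP
    obtain ⟨f, u, hfu, hux⟩ :=
      geometric_hahn_banach_closed_point hbody.convex hbody.isCompact.isClosed hxP
    have hu : 0 < u := by simpa using hfu 0 (interior_subset h0P)
    have hf : ∀ z, inner ℝ z (u⁻¹ • (InnerProductSpace.toDual ℝ _).symm f) = u⁻¹ * f z :=
      fun z => by
        rw [inner_smul_right, real_inner_comm, InnerProductSpace.toDual_symm_apply]
    have h1 := hxQ (u⁻¹ • (InnerProductSpace.toDual ℝ _).symm f) (fun s hs => by
      rw [hf, inv_mul_le_iff₀ hu, mul_one]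
      exact (hfu s (hSP s hs)).le)
    rw [hf, inv_mul_le_iff₀ hu, mul_one] at h1
    linarith

end Facets

/-! ### Existence of an isotropic position -/

section Existence

variable {n : ℕ} {K : Set (EuclideanSpace ℝ (Fin n))}

/-- The second moment matrix of the uniform measure on `K`. -/
noncomputable def covarianceMatrix (K : Set (EuclideanSpace ℝ (Fin n))) :
    Matrix (Fin n) (Fin n) ℝ :=
  Matrix.of fun i j => ∫ x in K, x i * x j

open Matrix in
theorem dotProduct_covarianceMatrix_mulVec (hc : IsCompact K)
    (θ φ : EuclideanSpace ℝ (Fin n)) :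
    θ.ofLp ⬝ᵥ (covarianceMatrix K *ᵥ φ.ofLp) = ∫ x in K, inner ℝ x θ * inner ℝ x φ := by
  have h1 : ∀ x : EuclideanSpace ℝ (Fin n), inner ℝ x θ * inner ℝ x φ =
      ∑ i, ∑ j, θ i * (x i * x j * φ j) := by
    intro x
    simp only [PiLp.inner_apply, RCLike.inner_apply, conj_trivial]
    rw [Finset.sum_mul_sum]
    refine Finset.sum_congr rfl fun i _ => Finset.sum_congr rfl fun j _ => ?_
    ring
  simp only [h1]
  rw [integral_finsetSum _ fun i _ => ContinuousOn.integrableOn_compact hc (by fun_prop)]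
  simp only [dotProduct, mulVec, covarianceMatrix, of_apply]
  refine Finset.sum_congr rfl fun i _ => ?_
  rw [integral_finsetSum _ fun j _ => ContinuousOn.integrableOn_compact hc (by fun_prop),
    Finset.mul_sum]
  refine Finset.sum_congr rfl fun j _ => ?_
  rw [integral_const_mul, integral_mul_const]

open Matrix in
theorem IsSymmConvexBody.covarianceMatrix_posDef (h : IsSymmConvexBody K) :
    (covarianceMatrix K).PosDef := by
  refine PosDef.of_dotProduct_mulVec_pos ?_ fun x hx => ?_
  · ext i j
    simp [covarianceMatrix, mul_comm]
  · set θ : EuclideanSpace ℝ (Fin n) := WithLp.toLp 2 x with hθ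
    have hθ0 : θ ≠ 0 := fun h0 => hx (congrArg WithLp.ofLp h0)
    have h1 := dotProduct_covarianceMatrix_mulVec h.isCompact θ θ
    rw [star_trivial]
    change 0 < θ.ofLp ⬝ᵥ (covarianceMatrix K *ᵥ θ.ofLp)
    rw [h1, setIntegral_pos_iff_support_of_nonneg_ae
      (Filter.Eventually.of_forall fun x => mul_self_nonneg _)
      (ContinuousOn.integrableOn_compact h.isCompact (by fun_prop))]
    have hopen : IsOpen (interior K ∩ {x | inner ℝ x θ ≠ 0}) :=
      isOpen_interior.inter (isOpen_ne_fun (by fun_prop) continuous_const)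
    refine (hopen.measure_pos volume ?_).trans_le (measure_mono ?_)
    · have h2 : Filter.Tendsto (fun c : ℝ => c • θ) (nhds 0) (nhds ((0 : ℝ) • θ)) :=
        Continuous.tendsto (by fun_prop) 0
      rw [zero_smul] at h2
      have h3 := h2.eventually (isOpen_interior.mem_nhds h.zero_mem_interior)
      obtain ⟨c, hc, hc0⟩ := ((h3.filter_mono nhdsWithin_le_nhds).and
        (self_mem_nhdsWithin : {0}ᶜ ∈ nhdsWithin (0 : ℝ) {0}ᶜ)).exists
      have hc0' : c ≠ 0 := hc0
      exact ⟨c • θ, hc, by simp [real_inner_smul_left, hc0', hθ0]⟩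
    · rintro x ⟨hx, hxθ⟩
      exact ⟨mul_self_ne_zero.2 hxθ, interior_subset hx⟩

theorem OrthonormalBasis.exists_diagonal_equiv
    (b : OrthonormalBasis (Fin n) ℝ (EuclideanSpace ℝ (Fin n))) {a : Fin n → ℝ}
    (ha : ∀ i, a i ≠ 0) :
    ∃ T : EuclideanSpace ℝ (Fin n) ≃L[ℝ] EuclideanSpace ℝ (Fin n),
      ∀ x i, inner ℝ (b i) (T x) = a i * inner ℝ (b i) x := by
  let T : EuclideanSpace ℝ (Fin n) →ₗ[ℝ] EuclideanSpace ℝ (Fin n) :=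
    ∑ i, (a i • (innerₛₗ ℝ (b i))).smulRight (b i)
  have hT : ∀ x i, inner ℝ (b i) (T x) = a i * inner ℝ (b i) x := by
    intro x i
    have h1 : T x = ∑ i, (a i * inner ℝ (b i) x) • b i := by
      simp [T]
    rw [h1, b.orthonormal.inner_right_fintype]
  have hinj : Function.Injective T := by
    rw [← LinearMap.ker_eq_bot, LinearMap.ker_eq_bot']
    intro x hx
    refine InnerProductSpace.ext_inner_left_basis b.toBasis fun i => ?_
    have := hT x i
    rw [hx, inner_zero_right, eq_comm, mul_eq_zero] at this
    simpa using this.resolve_left (ha i)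
  refine ⟨(LinearEquiv.ofInjectiveEndo T hinj).toContinuousLinearEquiv, fun x i => ?_⟩
  simpa using hT x i

/-- Change of variables for the second moments of a linear image. -/
theorem setIntegral_image_inner_sq (hc : MeasurableSet K)
    (T : EuclideanSpace ℝ (Fin n) ≃L[ℝ] EuclideanSpace ℝ (Fin n))
    (θ : EuclideanSpace ℝ (Fin n)) :
    ∫ x in T '' K, (inner ℝ x θ) ^ 2 =
      |(T : EuclideanSpace ℝ (Fin n) →L[ℝ] EuclideanSpace ℝ (Fin n)).det| *
        ∫ x in K, (inner ℝ (T x) θ) ^ 2 := by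
  rw [integral_image_eq_integral_abs_det_fderiv_smul volume hc
    (fun x _ => T.hasFDerivAt.hasFDerivWithinAt) T.injective.injOn, integral_smul, smul_eq_mul]

/-- Every symmetric convex body has an isotropic position. -/
theorem IsSymmConvexBody.exists_isIsotropicConstant (hn : 1 ≤ n) (h : IsSymmConvexBody K) :
    ∃ L : ℝ, IsIsotropicConstant K L := by
  have hC := h.covarianceMatrix_posDef
  set b := hC.1.eigenvectorBasis with hb
  set lam := hC.1.eigenvalues with hlam
  have hpos : ∀ i, 0 < lam i := hC.eigenvalues_pos
  have hbil : ∀ i j, ∫ x in K, inner ℝ x (b i) * inner ℝ x (b j) = if i = j then lam i else 0 := by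
    intro i j
    rw [← dotProduct_covarianceMatrix_mulVec h.isCompact, hC.1.mulVec_eigenvectorBasis]
    have h1 := orthonormal_iff_ite.1 b.orthonormal j i
    rw [EuclideanSpace.inner_eq_star_dotProduct, star_trivial] at h1
    rw [dotProduct_smul, h1]
    by_cases hij : i = j
    · simp [hij, hlam]
    · simp [hij, Ne.symm hij]
  have hsq : ∀ c : Fin n → ℝ, ∫ x in K, (∑ i, c i * inner ℝ x (b i)) ^ 2 =
      ∑ i, c i ^ 2 * lam i := by
    intro c
    have h1 : ∀ x : EuclideanSpace ℝ (Fin n), (∑ i, c i * inner ℝ x (b i)) ^ 2 =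
        ∑ i, ∑ j, c i * c j * (inner ℝ x (b i) * inner ℝ x (b j)) := by
      intro x
      rw [sq, Finset.sum_mul_sum]
      refine Finset.sum_congr rfl fun i _ => Finset.sum_congr rfl fun j _ => ?_
      ring
    simp only [h1]
    rw [integral_finsetSum _ fun i _ => ContinuousOn.integrableOn_compact h.isCompact
      (by fun_prop)]
    refine Finset.sum_congr rfl fun i _ => ?_
    rw [integral_finsetSum _ fun j _ => ContinuousOn.integrableOn_compact h.isCompact
      (by fun_prop)]
    simp only [integral_const_mul, hbil]
    simp [sq]
  have hn0 : n ≠ 0 := by omega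
  have hvpos : 0 < volume K :=
    (isOpen_interior.measure_pos volume h.interior_nonempty).trans_le
      (measure_mono interior_subset)
  have hvtop : volume K ≠ ⊤ := h.isCompact.measure_lt_top.ne
  have hv : 0 < (volume K).toReal := ENNReal.toReal_pos hvpos.ne' hvtop
  -- `T₁` whitens the covariance; its determinant serves to choose the factor c for which T = c `T₁`
  -- gives volume one.
  obtain ⟨T₁, hT₁⟩ := b.exists_diagonal_equiv (a := fun i => (√(lam i))⁻¹)
    (fun i => (inv_pos.2 (Real.sqrt_pos.2 (hpos i))).ne')
  have hdet₁ : LinearMap.det (T₁ : EuclideanSpace ℝ (Fin n) →ₗ[ℝ] EuclideanSpace ℝ (Fin n)) ≠ 0 :=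
    (LinearEquiv.isUnit_det' T₁.toLinearEquiv).ne_zero
  set D := |LinearMap.det (T₁ : EuclideanSpace ℝ (Fin n) →ₗ[ℝ] EuclideanSpace ℝ (Fin n))| *
    (volume K).toReal with hD
  have hD0 : 0 < D := mul_pos (abs_pos.2 hdet₁) hv
  set c : ℝ := (D⁻¹) ^ ((n : ℝ)⁻¹) with hc
  have hc0 : 0 < c := by positivity
  have hcn : c ^ n = D⁻¹ := Real.rpow_inv_natCast_pow (by positivity) hn0
  obtain ⟨T, hT⟩ := b.exists_diagonal_equiv (a := fun i => c * (√(lam i))⁻¹)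
    (fun i => (mul_pos hc0 (inv_pos.2 (Real.sqrt_pos.2 (hpos i)))).ne')
  have hTT : (T : EuclideanSpace ℝ (Fin n) →ₗ[ℝ] EuclideanSpace ℝ (Fin n)) =
      c • (T₁ : EuclideanSpace ℝ (Fin n) →ₗ[ℝ] EuclideanSpace ℝ (Fin n)) := by
    ext1 x
    refine InnerProductSpace.ext_inner_left_basis b.toBasis fun i => ?_
    have h1 := hT x i
    have h2 := hT₁ x i
    simp only [OrthonormalBasis.coe_toBasis, LinearMap.smul_apply, real_inner_smul_right]
    change inner ℝ (b i) (T x) = c * inner ℝ (b i) (T₁ x)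
    rw [h1, h2]
    ring
  have hdet : |LinearMap.det (T : EuclideanSpace ℝ (Fin n) →ₗ[ℝ] EuclideanSpace ℝ (Fin n))| *
      (volume K).toReal = 1 := by
    rw [hTT, LinearMap.det_smul, finrank_euclideanSpace, Fintype.card_fin, abs_mul,
      abs_of_pos (pow_pos hc0 n), mul_assoc, ← hD, hcn, inv_mul_cancel₀ hD0.ne']
  refine ⟨√(|(T : EuclideanSpace ℝ (Fin n) →L[ℝ] EuclideanSpace ℝ (Fin n)).det| * c ^ 2), T,
    ?_, Real.sqrt_nonneg _, fun θ hθ => ?_⟩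
  · have h1 := Measure.addHaar_image_continuousLinearEquiv volume T K
    rw [h1, ← ENNReal.ofReal_toReal hvtop, ← ENNReal.ofReal_mul (abs_nonneg _), hdet,
      ENNReal.ofReal_one]
  · rw [setIntegral_image_inner_sq h.isCompact.measurableSet, Real.sq_sqrt (by positivity)]
    congr 1
    have h1 : ∀ x, inner ℝ (T x) θ = ∑ i, (c * (√(lam i))⁻¹ * inner ℝ (b i) θ) *
        inner ℝ x (b i) := by
      intro x
      rw [← b.sum_inner_mul_inner]
      refine Finset.sum_congr rfl fun i _ => ?_
      rw [real_inner_comm (b i) (T x), hT, real_inner_comm (b i) x]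
      ring
    simp only [h1]
    rw [hsq]
    have h2 : ∑ i, (inner ℝ (b i) θ) ^ 2 = 1 := by
      have := b.sum_inner_mul_inner θ θ
      rw [real_inner_self_eq_norm_sq, hθ, one_pow] at this
      rw [← this]
      refine Finset.sum_congr rfl fun i _ => ?_
      rw [real_inner_comm (b i) θ]
      ring
    rw [← mul_one (c ^ 2), ← h2, Finset.mul_sum]
    refine Finset.sum_congr rfl fun i _ => ?_
    rw [mul_pow, mul_pow, inv_pow, Real.sq_sqrt (hpos i).le]
    have := (hpos i).ne'
    field_simp

end Existence

/-! ### Bounds in terms of facets and vertices -/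

section Bounds

variable {n : ℕ} {P : Set (EuclideanSpace ℝ (Fin n))}

/-- A symmetric convex hull of at most `N` points has isotropic constant `O(log N)`. -/
theorem IsSymmConvexBody.isotropicConstantLE_of_convexHull (hn : 1 ≤ n) (h : IsSymmConvexBody P)
    (S : Finset (EuclideanSpace ℝ (Fin n)))
    (hS : P = convexHull ℝ (S : Set (EuclideanSpace ℝ (Fin n)))) :
    IsotropicConstantLE P (4 * (Real.log S.card + 4)) := by
  classical
  refine ⟨h.exists_isIsotropicConstant hn, ?_⟩
  rintro L ⟨T, hT⟩
  have hne : S.Nonempty := by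
    rw [Finset.nonempty_iff_ne_empty]
    rintro rfl
    have := h.interior_nonempty
    simp [hS] at this
  have h1 := hT.le_log_card hn (by
    rintro _ ⟨x, hx, rfl⟩
    exact ⟨-x, h.neg_mem x hx, map_neg T x⟩) (S.image T) (by
      rw [hS, Finset.coe_image]
      exact T.toLinearMap.image_convexHull _)
  refine h1.trans ?_
  have h2 : Real.log (S.image T).card ≤ Real.log S.card :=
    Real.log_le_log (by exact_mod_cast (hne.image T).card_pos)
      (by exact_mod_cast Finset.card_image_le)
  linarith

theorem IsSymmPolytope.isotropicConstantLE_of_facets (hn : 1 ≤ n) (hP : IsSymmPolytope P) {m : ℕ}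
    (hm : (facets P).encard = ((2 * m : ℕ) : ℕ∞)) :
    IsotropicConstantLE P (4 * √(Real.log (1 + (m : ℝ)))) := by
  classical
  refine ⟨hP.1.exists_isIsotropicConstant hn, ?_⟩
  rintro L ⟨T, hT⟩
  obtain ⟨E, hE, hPE⟩ := hP.exists_halfSpaces hn hm
  -- Normals of T(P) are the images of those of P under the adjoint of T⁻¹.
  set A := ContinuousLinearMap.adjoint
    (T.symm : EuclideanSpace ℝ (Fin n) →L[ℝ] EuclideanSpace ℝ (Fin n)) with hA
  have h1 := hT.sq_le_log_card hn (hP.1.isCompact.image T.continuous) (by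
    rintro _ ⟨x, hx, rfl⟩
    exact ⟨-x, hP.1.neg_mem x hx, map_neg T x⟩) (E.image A) (by
      ext x
      have h2 : x ∈ T '' P ↔ T.symm x ∈ P := by
        rw [T.image_eq_preimage_symm]
        rfl
      rw [h2, hPE]
      simp [hA, ContinuousLinearMap.adjoint_inner_right])
  have hcard : ((E.image A).card : ℝ) ≤ 2 * m := by
    exact_mod_cast Finset.card_image_le.trans hE
  -- This is 4m ≤ (1 + m)³ for m ≥ 1; in the empty case the left side is `Real.log 0 = 0`.
  have hlog : Real.log (2 * (E.image A).card) ≤ 3 * Real.log (1 + (m : ℝ)) := by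
    rcases Nat.eq_zero_or_pos (E.image A).card with h0 | h0
    · rw [h0]
      have := Real.log_nonneg (x := 1 + (m : ℝ)) (by simp)
      simpa using this
    · have h0' : (0 : ℝ) < (E.image A).card := by exact_mod_cast h0
      have hm1 : (1 : ℝ) ≤ m := by
        have : 0 < m := by
          have h3 := h0.trans_le (Finset.card_image_le.trans hE)
          omega
        exact_mod_cast this
      have h4 : 3 * Real.log (1 + (m : ℝ)) = Real.log ((1 + m) ^ 3) := by
        rw [Real.log_pow]; norm_num
      rw [h4]
      apply Real.log_le_log (by positivity)
      have h5 : (m : ℝ) ≤ m ^ 2 := by nlinarith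
      have h6 : (0 : ℝ) ≤ m ^ 3 := by positivity
      linarith [show (1 + (m : ℝ)) ^ 3 = 1 + 3 * m + 3 * m ^ 2 + m ^ 3 by ring]
  have hnn := Real.log_nonneg (x := 1 + (m : ℝ)) (by simp)
  refine le_of_sq_le_sq ?_ (by positivity)
  rw [mul_pow, Real.sq_sqrt hnn]
  linarith

theorem IsSymmPolytope.isotropicConstantLE_of_vertices (hn : 1 ≤ n) (hP : IsSymmPolytope P) {m : ℕ}
    (hm : (vertices P).encard = ((2 * m : ℕ) : ℕ∞)) :
    IsotropicConstantLE P (40 * Real.log (1 + (m : ℝ))) := by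
  have hfin : (vertices P).Finite := Set.finite_of_encard_eq_coe hm
  have hcard : hfin.toFinset.card = 2 * m := by
    rw [hfin.encard_eq_coe_toFinset_card] at hm
    exact_mod_cast hm
  have hconv : P = convexHull ℝ (hfin.toFinset : Set (EuclideanSpace ℝ (Fin n))) := by
    rw [hfin.coe_toFinset]
    have h1 := closure_convexHull_extremePoints hP.1.isCompact hP.1.convex
    have h2 : IsClosed (convexHull ℝ (vertices P)) := hfin.isClosed_convexHull ℝ
    rw [← h2.closure_eq]
    exact h1.symm
  have h1 := hP.1.isotropicConstantLE_of_convexHull hn hfin.toFinset hconv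
  refine ⟨h1.1, fun L hL => (h1.2 L hL).trans ?_⟩
  have hm0 : m ≠ 0 := by
    rintro rfl
    have h2 := Finset.card_eq_zero.1 hcard
    have := hP.1.interior_nonempty
    rw [hconv, h2] at this
    simp at this
  have hm1 : (1 : ℝ) ≤ m := by exact_mod_cast Nat.one_le_iff_ne_zero.2 hm0
  rw [hcard]
  have h2 : Real.log ((2 * m : ℕ) : ℝ) ≤ 2 * Real.log (1 + (m : ℝ)) := by
    have h4 : 2 * Real.log (1 + (m : ℝ)) = Real.log ((1 + m) ^ 2) := by
      rw [Real.log_pow]; norm_num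
    rw [h4]
    push_cast
    apply Real.log_le_log (by positivity)
    nlinarith
  have h3 : Real.log 2 ≤ Real.log (1 + (m : ℝ)) := Real.log_le_log (by norm_num) (by linarith)
  have h4 := Real.log_two_gt_d9
  linarith

end Bounds

/-! ### Gluskin's polytopes, for arbitrary unit vectors -/

section Gluskin

variable {n k : ℕ}

open Classical in
/-- The points whose convex hull is Gluskin's polytope. -/
noncomputable def gluskinPoints
    (f : Fin k → Metric.sphere (0 : EuclideanSpace ℝ (Fin n)) 1) :
    Finset (EuclideanSpace ℝ (Fin n)) :=
  (Finset.univ.image (fun i : Fin n => EuclideanSpace.single i (1 : ℝ)) ∪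
    Finset.univ.image (fun i : Fin n => -EuclideanSpace.single i (1 : ℝ))) ∪
  (Finset.univ.image (fun j : Fin k => (f j : EuclideanSpace ℝ (Fin n))) ∪
    Finset.univ.image (fun j : Fin k => -(f j : EuclideanSpace ℝ (Fin n))))

theorem gluskinPolytope_eq (f : Fin k → Metric.sphere (0 : EuclideanSpace ℝ (Fin n)) 1) :
    gluskinPolytope f =
      convexHull ℝ (gluskinPoints f : Set (EuclideanSpace ℝ (Fin n))) := by
  unfold gluskinPolytope gluskinPoints
  congr 1
  ext x
  simp [eq_comm, exists_or, or_assoc]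

theorem card_gluskinPoints_le (f : Fin k → Metric.sphere (0 : EuclideanSpace ℝ (Fin n)) 1) :
    (gluskinPoints f).card ≤ 2 * (n + k) := by
  classical
  have h : ∀ (l : ℕ) (g : Fin l → EuclideanSpace ℝ (Fin n)), (Finset.univ.image g).card ≤ l :=
    fun l g => Finset.card_image_le.trans (by simp)
  unfold gluskinPoints
  refine (Finset.card_union_le _ _).trans ((add_le_add (Finset.card_union_le _ _)
    (Finset.card_union_le _ _)).trans ?_)
  refine (add_le_add (add_le_add (h _ _) (h _ _)) (add_le_add (h _ _) (h _ _))).trans ?_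
  omega

theorem isSymmPolytope_gluskinPolytope (hn : 1 ≤ n)
    (f : Fin k → Metric.sphere (0 : EuclideanSpace ℝ (Fin n)) 1) :
    IsSymmPolytope (gluskinPolytope f) := by
  rw [gluskinPolytope_eq]
  set S : Set (EuclideanSpace ℝ (Fin n)) := ↑(gluskinPoints f) with hS
  have hSf : S.Finite := (gluskinPoints f).finite_toSet
  have hmem : ∀ i : Fin n, EuclideanSpace.single i (1 : ℝ) ∈ S ∧
      -EuclideanSpace.single i (1 : ℝ) ∈ S := fun i => by simp [hS, gluskinPoints]
  have hneg : ∀ x ∈ S, -x ∈ S := by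
    intro x hx
    simp only [hS, gluskinPoints, Finset.coe_union, Finset.coe_image, Finset.coe_univ,
      Set.image_univ, Set.mem_union, Set.mem_range] at hx ⊢
    rcases hx with (⟨i, rfl⟩ | ⟨i, rfl⟩) | (⟨i, rfl⟩ | ⟨i, rfl⟩) <;> simp
  refine ⟨⟨convex_convexHull ℝ _, hSf.isCompact_convexHull ℝ, ?_, ?_⟩, S, hSf, rfl⟩
  · rw [interior_convexHull_nonempty_iff_affineSpan_eq_top,
      AffineSubspace.affineSpan_eq_top_iff_vectorSpan_eq_top_of_nonempty ℝ _ _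
        ⟨_, (hmem ⟨0, hn⟩).1⟩, eq_top_iff,
      ← (EuclideanSpace.basisFun (Fin n) ℝ).toBasis.span_eq, Submodule.span_le]
    rintro _ ⟨i, rfl⟩
    have h1 := vsub_mem_vectorSpan ℝ (hmem i).1 (hmem i).2
    have h2 := Submodule.smul_mem _ (2⁻¹ : ℝ) h1
    have h3 : (2⁻¹ : ℝ) • (EuclideanSpace.single i (1 : ℝ) -ᵥ -EuclideanSpace.single i (1 : ℝ)) =
        EuclideanSpace.single i (1 : ℝ) := by
      rw [vsub_eq_sub]
      module
    rw [h3] at h2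
    simpa using h2
  · intro x hx
    have h1 : convexHull ℝ S ⊆ (-LinearMap.id : EuclideanSpace ℝ (Fin n) →ₗ[ℝ] _) ⁻¹' convexHull ℝ S :=
      convexHull_min (fun y hy => subset_convexHull ℝ S (hneg y hy))
        ((convex_convexHull ℝ S).linear_preimage _)
    exact h1 hx

theorem isotropicConstantLE_gluskinPolytope (hn : 1 ≤ n) {A : ℕ} (hk : k ≤ A * n)
    (f : Fin k → Metric.sphere (0 : EuclideanSpace ℝ (Fin n)) 1) :
    IsotropicConstantLE (gluskinPolytope f)
      ((36 + 8 * Real.log (2 * (A + 1))) * Real.log (1 + (n : ℝ))) := by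
  have h1 := (isSymmPolytope_gluskinPolytope hn f).1.isotropicConstantLE_of_convexHull hn
    (gluskinPoints f) (gluskinPolytope_eq f)
  refine ⟨h1.1, fun L hL => (h1.2 L hL).trans ?_⟩
  have hn1 : (1 : ℝ) ≤ n := by exact_mod_cast hn
  have hA : 0 ≤ Real.log (2 * (A + 1)) := Real.log_nonneg (by
    have : (0 : ℝ) ≤ A := by positivity
    linarith)
  have hpos : (0 : ℝ) < (gluskinPoints f).card := by
    have : (gluskinPoints f).Nonempty :=
      ⟨EuclideanSpace.single ⟨0, hn⟩ 1, by simp [gluskinPoints]⟩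
    exact_mod_cast this.card_pos
  have hcard : ((gluskinPoints f).card : ℝ) ≤ 2 * (A + 1) * n := by
    have := card_gluskinPoints_le f
    have h2 : (gluskinPoints f).card ≤ 2 * (A + 1) * n := by nlinarith
    exact_mod_cast h2
  have h2 := Real.log_le_log hpos hcard
  rw [Real.log_mul (by positivity) (by positivity)] at h2
  have h3 : Real.log n ≤ Real.log (1 + (n : ℝ)) := Real.log_le_log (by linarith) (by linarith)
  -- As log(1 + n) ≥ 1/2, the additive terms 16 and 4 log(2(A + 1)) are absorbed at the price of a
  -- factor 2, giving 36 = 4 + 32 and 8.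
  have h4 : Real.log 2 ≤ Real.log (1 + (n : ℝ)) := Real.log_le_log (by norm_num) (by linarith)
  have h5 := Real.log_two_gt_d9
  nlinarith

end Gluskin

theorem mainTheorem9 :
    (∃ C : ℝ, 0 < C ∧ ∀ n : ℕ, 1 ≤ n → ∀ (m : ℕ) (P : Set (EuclideanSpace ℝ (Fin n))),
      IsSymmPolytope P → (facets P).encard = ((2 * m : ℕ) : ℕ∞) →
        IsotropicConstantLE P (C * √(Real.log (1 + (m : ℝ))))) ∧
    (∃ C : ℝ, 0 < C ∧ ∀ n : ℕ, 1 ≤ n → ∀ (m : ℕ) (P : Set (EuclideanSpace ℝ (Fin n))),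
      IsSymmPolytope P → (vertices P).encard = ((2 * m : ℕ) : ℕ∞) →
        IsotropicConstantLE P (C * Real.log (1 + (m : ℝ)))) ∧
    (∀ A : ℕ, ∃ C : ℝ, 0 < C ∧ ∀ n : ℕ, 1 ≤ n → ∀ k : ℕ, k ≤ A * n →
      ∀ᵐ f ∂(gluskinLaw n k),
        IsSymmPolytope (gluskinPolytope f) ∧
          IsotropicConstantLE (gluskinPolytope f) (C * Real.log (1 + (n : ℝ)))) := by
  refine ⟨⟨4, by norm_num, fun n hn m P hP hm => hP.isotropicConstantLE_of_facets hn hm⟩,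
    ⟨40, by norm_num, fun n hn m P hP hm => hP.isotropicConstantLE_of_vertices hn hm⟩,
    fun A => ⟨36 + 8 * Real.log (2 * (A + 1)), ?_, fun n hn k hk => ?_⟩⟩
  · have hA : 0 ≤ Real.log (2 * (A + 1)) := Real.log_nonneg (by
      have : (0 : ℝ) ≤ A := by positivity
      linarith)
    positivity
  · exact Filter.Eventually.of_forall fun f =>
      ⟨isSymmPolytope_gluskinPolytope hn f, isotropicConstantLE_gluskinPolytope hn hk f⟩
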